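/- **Rings.** Let $R$ be a square-free ring, i.e. a basic, indecomposable, (left and right) artinian ring with identity such that every indecomposable direct summand of ${}_RR$ and of $R_R$ has each simple module at most once among its composition factors. Let $\operatorname{Out}R=\operatorname{Aut}R/\operatorname{Inn}R$, where $\operatorname{Aut}R$ is the group of ring automorphisms and $\operatorname{Inn}R$ the subgroup of the maps $\rho_r:x\mapsto rxr^{-1}$, $r\in R$ invertible. **Semigroups.** A square-free semigroup is a semigroup $S$ with zero $\theta$ and a finite set $E$ of pairwise orthogonal nonzero idempotents such that $S=\bigcup_{e,f\in E}e\cdot S\cdot f$ and $|e\cdot S\cdot f\setminus\{\theta\}|\le 1$ for all $e,f\in E$. Put $S^*=S\setminus\{\theta\}$; for every $s\in S^*$ there are unique $e,f\in E$ with $s=e\cdot s\cdot f$. Let $S^{<2>}$ be the set of pairs $(s,t)$ with $s\cdot t\neq\theta$, and let $\operatorname{Aut}S$ be the group of semigroup automorphisms of $S$. **Cocycles.** Let $D$ be a division ring with unit group $D^*$ and group of ring automorphisms $\operatorname{Aut}D$, and let $\rho_d(x)=dxd^{-1}$. A 2-cocycle $(\alpha,\xi)\in Z^2(S,D^*)$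 is a pair of functions $\alpha:S^*\to\operatorname{Aut}D$, $\xi:S^{<2>}\to D^*$ with $$\alpha_s(\xi(t,u))\,\xi(s,t\cdot u)=\xi(s,t)\,\xi(s\cdot t,u),\qquad \alpha_s\circ\alpha_t=\rho_{\xi(s,t)}\circ\alpha_{s\cdot t}$$ whenever $s\cdot t\cdot u\ne\theta$, respectively $s\cdot t\neq\theta$. It is normal if $\alpha_e=1_D$ and $\xi(e,e)=1$ for all $e\in E$. The twisted semigroup ring $D^\alpha_\xi S$ is the left $D$-vector space with basis $S^*$ and the biadditive multiplication $(ds)(d't)=d\,\alpha_s(d')\,\xi(s,t)\,(s\cdot t)$ if $s\cdot t\ne\theta$, and $(ds)(d't)=0$ otherwise. Let $G$ be the group of pairs $(\mu,\eta)$ of functions $\mu:E\to\operatorname{Aut}D$, $\eta:S^*\to D^*$ with $(\mu,\eta)(\mu',\eta')=(\mu\mu',\ s\mapsto\mu_e(\eta'(s))\,\eta(s))$ for $s=e\cdot s$. Write $(\mu,\eta)*(\alpha,\xi)=(\beta,\zeta)$ if $$\mu_e\circ\beta_s\circ\mu_f^{-1}=\rho_{\eta(s)}\circ\alpha_s,\qquad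 \mu_e(\zeta(s,t))=\eta(s)\,\alpha_s(\eta(t))\,\xi(s,t)\,\eta(s\cdot t)^{-1}$$ for all $s=e\cdot s\cdot f\in S^*$, respectively all $(s,t)\in S^{<2>}$ with $s=e\cdot s$, and write $[\alpha,\xi]=[\beta,\zeta]$ if such a pair $(\mu,\eta)$ exists. Let $Z^1_{(\alpha,\xi)}(S,D^*)=\{g\in G: g*(\alpha,\xi)=(\alpha,\xi)\}$. Let $B^1_{(\alpha,\xi)}(S,D^*)$ be its normal subgroup of the pairs $(e\mapsto\rho_{\epsilon(e)},\ s\mapsto\epsilon(e)\,\alpha_s(\epsilon(f)^{-1}))$, $s=e\cdot s\cdot f$, for $\epsilon:E\to D^*$, and $H^1_{(\alpha,\xi)}(S,D^*)=Z^1_{(\alpha,\xi)}(S,D^*)/B^1_{(\alpha,\xi)}(S,D^*)$. For $\phi\in\operatorname{Aut}S$ put $\alpha^\phi_s=\alpha_{\phi(s)}$, $\xi^\phi(s,t)=\xi(\phi(s),\phi(t))$, and let $\operatorname{Stab}_{[\alpha,\xi]}(\operatorname{Aut}S)=\{\phi\in\operatorname{Aut}S:[\alpha,\xi]=[\alpha^\phi,\xi^\phi]\}$,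 a subgroup of $\operatorname{Aut}S$. **Theorem.** Let $R$ be a square-free ring, $S$ a square-free semigroup, $D$ a division ring and $(\alpha,\xi)\in Z^2(S,D^*)$ a normal 2-cocycle with $R\cong D^\alpha_\xi S$, and identify $R$ with $D^\alpha_\xi S$. Then there is an exact sequence of groups $$1\longrightarrow H^1_{(\alpha,\xi)}(S,D^*)\overset{\Lambda}{\longrightarrow}\operatorname{Out}R\overset{\Phi}{\longrightarrow}\operatorname{Stab}_{[\alpha,\xi]}(\operatorname{Aut}S)\longrightarrow 1,$$ where $\Lambda$ sends the class of $(\mu,\eta)$ to the class of the automorphism $ds\mapsto\mu_e(d)\,\eta(s)\,s$ ($d\in D$, $s=e\cdot s\in S^*$), every class in $\operatorname{Out}R$ contains an automorphism of the form $ds\mapsto\mu_e(d)\,\eta(s)\,\phi(s)$ with $(\mu,\eta)\in G$ and $\phi\in\operatorname{Aut}S$, and $\Phi$ sends the class of each automorphism of this form to $\phi$. If $[\alpha,\xi]=[1_D,1]$, then $\operatorname{Stab}_{[\alpha,\xi]}(\operatorname{Aut}S)=\operatorname{Aut}S$, the sequence $$1\longrightarrow H^1_{(\alpha,\xi)}(S,D^*)\overset{\Lambda}{\longrightarrow}\operatorname{Out}R\overset{\Phi}{\longrightarrow}\operatorname{Aut}S\longrightarrow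 1$$ is exact and splits, by a homomorphism $\Psi:\operatorname{Aut}S\to\operatorname{Out}R$ with $\Phi\Psi=1$, and hence $\operatorname{Out}R$ is isomorphic, via $(h,\phi)\mapsto\Lambda(h)\Psi(\phi)$, to a semidirect product $H^1_{(\alpha,\xi)}(S,D^*)\rtimes\operatorname{Aut}S$. -/

import Mathlib

/-! ### Square-free rings -/

namespace SquareFree

universe u v w

/-- The inner automorphism `ρ_r : x ↦ r x r⁻¹` of a ring, as a homomorphism in the unit `r`. -/
def inner (R : Type u) [Ring R] : Rˣ →* RingAut R where
  toFun r :=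
    { toFun := fun x => r * x * (r⁻¹ : Rˣ)
      invFun := fun x => (r⁻¹ : Rˣ) * x * r
      left_inv := fun x => by simp [mul_assoc]
      right_inv := fun x => by simp [mul_assoc]
      map_mul' := fun x y => by simp [mul_assoc]
      map_add' := fun x y => by simp [mul_add, add_mul] }
  map_one' := by ext x; simp
  map_mul' r r' := by ext x; simp [mul_assoc]

@[simp] theorem inner_apply {R : Type u} [Ring R] (r : Rˣ) (x : R) :
    inner R r x = r * x * (r⁻¹ : Rˣ) := rfl

/-- The group `Inn R` of inner automorphisms. -/
def Inn (R : Type u) [Ring R] : Subgroup (RingAut R) := (inner R).range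

instance (R : Type u) [Ring R] : (Inn R).Normal where
  conj_mem := by
    rintro _ ⟨r, rfl⟩ g
    refine ⟨Units.map (g : R →* R) r, ?_⟩
    ext x
    simp [← map_inv]

/-- The outer automorphism group `Out R = Aut R / Inn R`. -/
abbrev Out (R : Type u) [Ring R] : Type u := RingAut R ⧸ Inn R

/-- An indecomposable module: nonzero, and not a direct sum of two nonzero submodules. -/
def IsIndecomposableModule (R : Type u) [Ring R] (M : Type v) [AddCommGroup M] [Module R M] :
    Prop :=
  Nontrivial M ∧ ∀ p q : Submodule R M, IsCompl p q → p = ⊥ ∨ q = ⊥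

/-- The number of factors of the composition series `s` that are isomorphic to `T`. -/
noncomputable def compMultiplicity {R : Type u} [Ring R] {M : Type v} [AddCommGroup M] [Module R M]
    (s : CompositionSeries (Submodule R M)) (T : Type w) [AddCommGroup T] [Module R T] : ℕ :=
  Nat.card {i : Fin s.length //
    Nonempty ((↥(s i.succ) ⧸ (s i.castSucc).submoduleOf (s i.succ)) ≃ₗ[R] T)}

/-- A module is square-free if it is finitely generated and in each of its indecomposable direct
summands every simple module has composition multiplicity at most one. -/
def IsSquareFreeModule (R : Type u) [Ring R] (M : Type u) [AddCommGroup M] [Module R M] : Prop :=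
  Module.Finite R M ∧
  ∀ N : Submodule R M, (∃ N' : Submodule R M, IsCompl N N') → IsIndecomposableModule R N →
    ∀ s : CompositionSeries (Submodule R N), s.head = ⊥ → s.last = ⊤ →
      ∀ (T : Type u) [AddCommGroup T] [Module R T] [IsSimpleModule R T], compMultiplicity s T ≤ 1

/-- A primitive idempotent. -/
def IsPrimitiveIdempotent {R : Type u} [Ring R] (e : R) : Prop :=
  IsIdempotentElem e ∧ e ≠ 0 ∧
  ∀ f g : R, IsIdempotentElem f → IsIdempotentElem g → f * g = 0 → g * f = 0 → e = f + g →
    f = 0 ∨ g = 0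

/-- A basic ring: `1` is a sum of orthogonal primitive idempotents `e₁, …, eₙ` such that the left
modules `R e₁, …, R eₙ` are pairwise non-isomorphic. -/
def IsBasicRing (R : Type u) [Ring R] : Prop :=
  ∃ (n : ℕ) (e : Fin n → R), CompleteOrthogonalIdempotents e ∧
    (∀ i, IsPrimitiveIdempotent (e i)) ∧
    ∀ i j, Nonempty (Submodule.span R {e i} ≃ₗ[R] Submodule.span R {e j}) → i = j

/-- An indecomposable ring: nonzero, with no nontrivial central idempotent. -/
def IsIndecomposableRing (R : Type u) [Ring R] : Prop :=
  Nontrivial R ∧ ∀ e : R, IsIdempotentElem e → (∀ x, e * x = x * e) → e = 0 ∨ e = 1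

/-- A square-free ring: a basic indecomposable (left and right) artinian ring that is square-free
as a left and as a right module over itself. Right modules are modules over `Rᵐᵒᵖ`. -/
structure IsSquareFreeRing (R : Type u) [Ring R] : Prop where
  basic : IsBasicRing R
  indecomposable : IsIndecomposableRing R
  leftArtinian : IsArtinianRing R
  rightArtinian : IsArtinianRing Rᵐᵒᵖ
  leftSquareFree : IsSquareFreeModule R R
  rightSquareFree : IsSquareFreeModule Rᵐᵒᵖ R

/-! ### Square-free semigroups -/

/-- The set `S* = S \ {θ}` of nonzero elements (the zero `θ` of `S` is written `0`). -/
abbrev NZ (S : Type v) [Zero S] : Type v := {s : S // s ≠ 0}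

/-- The set `E` of nonzero idempotents of `S`. -/
abbrev Idem (S : Type v) [SemigroupWithZero S] : Type v := {e : S // e * e = e ∧ e ≠ 0}

/-- A square-free semigroup: a semigroup with zero `θ = 0` and with a finite set `E` of pairwise
orthogonal nonzero idempotents such that `S = ⋃ e S f` and `|e S f \ {θ}| ≤ 1` for `e, f ∈ E`.
Such an `E` necessarily consists of all nonzero idempotents: if `s ∈ e S f` with `e ≠ f`, then
`s * s = 0`, and `e` is the only nonzero element of `e S e`. -/
class SquareFreeSemigroup (S : Type v) [SemigroupWithZero S] : Prop where
  finite_idem : Finite (Idem S)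
  orthogonal : ∀ e f : Idem S, e ≠ f → (e : S) * f = 0
  cover : ∀ s : S, s ≠ 0 → ∃ e f : Idem S, ∃ t : S, s = e * t * f
  thin : ∀ e f : Idem S, ({s : S | ∃ t : S, s = e * t * f} \ {0}).Subsingleton

section Semigroup

theorem map_ne_zero {S : Type v} [SemigroupWithZero S] (φ : MulAut S) {s : S} (h : s ≠ 0) :
    φ s ≠ 0 := fun h0 => h <| by
  have : φ 0 = 0 := by
    have h1 := φ.map_mul 0 (φ.symm 0)
    rwa [zero_mul, MulEquiv.apply_symm_apply, mul_zero] at h1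
  exact φ.injective (h0.trans this.symm)

/-- A semigroup automorphism acts on `S*`. -/
def NZ.map {S : Type v} [SemigroupWithZero S] (φ : MulAut S) (s : NZ S) : NZ S :=
  ⟨φ s, map_ne_zero φ s.2⟩

/-- A semigroup automorphism acts on `E`. -/
def Idem.map {S : Type v} [SemigroupWithZero S] (φ : MulAut S) (e : Idem S) : Idem S :=
  ⟨φ e, by rw [← map_mul, e.2.1], map_ne_zero φ e.2.2⟩

/-- An element of `E`, as an element of `S*`. -/
def Idem.toNZ {S : Type v} [SemigroupWithZero S] (e : Idem S) : NZ S := ⟨e, e.2.2⟩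

/-- The product of two elements of `S*` whose product is nonzero. -/
def NZ.mul {S : Type v} [SemigroupWithZero S] (s t : NZ S) (h : (s * t : S) ≠ 0) : NZ S :=
  ⟨s * t, h⟩

theorem NZ.map_mul_ne_zero {S : Type v} [SemigroupWithZero S] (φ : MulAut S) {s t : NZ S}
    (h : (s * t : S) ≠ 0) : (NZ.map φ s * NZ.map φ t : S) ≠ 0 := by
  have := map_ne_zero φ h
  rwa [map_mul] at this

theorem NZ.map_mul {S : Type v} [SemigroupWithZero S] (φ : MulAut S) {s t : NZ S}
    (h : (s * t : S) ≠ 0) :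
    NZ.map φ (NZ.mul s t h) = NZ.mul (NZ.map φ s) (NZ.map φ t) (NZ.map_mul_ne_zero φ h) :=
  Subtype.ext (_root_.map_mul φ _ _)

variable {S : Type v} [SemigroupWithZero S] [SquareFreeSemigroup S]

theorem exists_lid_rid (s : NZ S) : ∃ p : Idem S × Idem S, (p.1 : S) * s * p.2 = s := by
  obtain ⟨e, f, t, h⟩ := SquareFreeSemigroup.cover s.1 s.2
  refine ⟨(e, f), ?_⟩
  rw [h]
  calc (e : S) * (e * t * f) * f = (e * e) * t * (f * f) := by simp only [mul_assoc]
    _ = _ := by rw [e.2.1, f.2.1]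

/-- The idempotent `e` in `s = e · s · f`. -/
noncomputable def lid (s : NZ S) : Idem S := (exists_lid_rid s).choose.1

/-- The idempotent `f` in `s = e · s · f`. -/
noncomputable def rid (s : NZ S) : Idem S := (exists_lid_rid s).choose.2

theorem lid_mul_mul_rid (s : NZ S) : (lid s : S) * s * rid s = s := (exists_lid_rid s).choose_spec

theorem lid_mul (s : NZ S) : (lid s : S) * s = s := by
  conv_lhs => rw [← lid_mul_mul_rid s]
  rw [← mul_assoc, ← mul_assoc, (lid s).2.1, lid_mul_mul_rid]

theorem mul_rid (s : NZ S) : (s : S) * rid s = s := by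
  conv_lhs => rw [← lid_mul_mul_rid s]
  rw [mul_assoc, (rid s).2.1, lid_mul_mul_rid]

theorem eq_lid (s : NZ S) (e : Idem S) (h : (e : S) * s ≠ 0) : e = lid s := by
  by_contra hne
  apply h
  rw [← lid_mul s, ← mul_assoc, SquareFreeSemigroup.orthogonal e _ hne, zero_mul]

theorem eq_rid (s : NZ S) (f : Idem S) (h : (s : S) * f ≠ 0) : f = rid s := by
  by_contra hne
  apply h
  rw [← mul_rid s, mul_assoc, SquareFreeSemigroup.orthogonal _ f (Ne.symm hne), mul_zero]

theorem rid_eq_lid {s t : NZ S} (h : (s * t : S) ≠ 0) : rid s = lid t := by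
  apply eq_lid
  intro h0
  apply h
  rw [← mul_rid s, mul_assoc, h0, mul_zero]

theorem lid_nzmul {s t : NZ S} (h : (s * t : S) ≠ 0) : lid (NZ.mul s t h) = lid s := by
  symm
  apply eq_lid
  change (lid s : S) * (s * t) ≠ 0
  rwa [← mul_assoc, lid_mul]

theorem rid_nzmul {s t : NZ S} (h : (s * t : S) ≠ 0) : rid (NZ.mul s t h) = rid t := by
  symm
  apply eq_rid
  change (s * t : S) * rid t ≠ 0
  rwa [mul_assoc, mul_rid]

theorem lid_map (φ : MulAut S) (s : NZ S) : lid (NZ.map φ s) = Idem.map φ (lid s) := by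
  symm
  apply eq_lid
  change φ (lid s) * φ s ≠ 0
  rw [← map_mul, lid_mul]
  exact map_ne_zero φ s.2

theorem rid_map (φ : MulAut S) (s : NZ S) : rid (NZ.map φ s) = Idem.map φ (rid s) := by
  symm
  apply eq_rid
  change φ s * φ (rid s) ≠ 0
  rw [← map_mul, mul_rid]
  exact map_ne_zero φ s.2

theorem lid_toNZ (e : Idem S) : lid e.toNZ = e := by
  symm
  apply eq_lid
  change (e * e : S) ≠ 0
  rw [e.2.1]
  exact e.2.2

theorem rid_toNZ (e : Idem S) : rid e.toNZ = e := by
  symm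
  apply eq_rid
  change (e * e : S) ≠ 0
  rw [e.2.1]
  exact e.2.2

end Semigroup

/-! ### Cocycles with coefficients in the unit group of a division ring -/

/-- A 2-cocycle `(α, ξ)`: functions `α : S* → Aut D` and `ξ : S^{<2>} → D*`, where `S^{<2>}` is
the set of pairs with nonzero product, subject to the two cocycle identities. -/
@[ext]
structure TwoCocycle (S : Type v) [SemigroupWithZero S] (D : Type w) [DivisionRing D] where
  α : NZ S → RingAut D
  ξ : ∀ s t : NZ S, (s * t : S) ≠ 0 → Dˣ
  cocycle : ∀ (s t u : NZ S) (hst : (s * t : S) ≠ 0) (htu : (t * u : S) ≠ 0)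
    (h : (s * (t * u) : S) ≠ 0) (h' : (s * t * u : S) ≠ 0),
    α s (ξ t u htu) * ξ s (NZ.mul t u htu) h = (ξ s t hst * ξ (NZ.mul s t hst) u h' : D)
  twist : ∀ (s t : NZ S) (h : (s * t : S) ≠ 0),
    α s * α t = inner D (ξ s t h) * α (NZ.mul s t h)

/-- The group `F⁰(S, Aut D) ⋉ F¹(S, D*)` of pairs `(μ, η)` of functions `μ : E → Aut D` and
`η : S* → D*`. -/
@[ext]
structure OneCochain (S : Type v) [SemigroupWithZero S] (D : Type w) [DivisionRing D] where
  μ : Idem S → RingAut D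
  η : NZ S → Dˣ

namespace OneCochain

variable {S : Type v} [SemigroupWithZero S] [SquareFreeSemigroup S] {D : Type w} [DivisionRing D]

/-- `(μ, η) (μ', η') = (μ μ', s ↦ μ_e(η'(s)) η(s))` for `s = e · s`: the multiplication for which
`(d s ↦ μ_e(d) η(s) s)` is compatible with composition. -/
noncomputable instance : Mul (OneCochain S D) where
  mul g g' :=
    { μ := fun e => g.μ e * g'.μ e
      η := fun s => Units.map (g.μ (lid s) : D →* D) (g'.η s) * g.η s }

instance : One (OneCochain S D) where
  one := { μ := fun _ => 1, η := fun _ => 1 }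

noncomputable instance : Inv (OneCochain S D) where
  inv g :=
    { μ := fun e => (g.μ e)⁻¹
      η := fun s => Units.map (((g.μ (lid s))⁻¹ : RingAut D) : D →* D) (g.η s)⁻¹ }

theorem mul_μ (g g' : OneCochain S D) (e : Idem S) : (g * g').μ e = g.μ e * g'.μ e := rfl

theorem mul_η (g g' : OneCochain S D) (s : NZ S) :
    (g * g').η s = Units.map (g.μ (lid s) : D →* D) (g'.η s) * g.η s := rfl

noncomputable instance : Group (OneCochain S D) where
  mul_assoc a b c := by
    ext s
    · rfl
    · simp [mul_η, mul_μ, mul_assoc]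
  one_mul a := by
    ext s
    · rfl
    · change ((1 : RingAut D) (a.η s) : D) * ((1 : Dˣ) : D) = _
      simp
  mul_one a := by
    ext s
    · rfl
    · change a.μ (lid s) ((1 : Dˣ) : D) * (a.η s : D) = _
      simp
  inv_mul_cancel a := by
    ext s
    · exact (a.μ s).symm_apply_apply _
    · change (a.μ (lid s)).symm (a.η s : D) * (a.μ (lid s)).symm ((a.η s)⁻¹ : Dˣ) = ((1 : Dˣ) : D)
      rw [← map_mul]
      simp

end OneCochain

namespace TwoCocycle

variable {S : Type v} [SemigroupWithZero S] {D : Type w} [DivisionRing D]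

/-- A normal cocycle: `α_e = 1_D` and `ξ(e, e) = 1` for all `e ∈ E`. -/
def IsNormal (x : TwoCocycle S D) : Prop :=
  ∀ e : Idem S, x.α e.toNZ = 1 ∧ ∀ h : (e.toNZ * e.toNZ : S) ≠ 0, x.ξ e.toNZ e.toNZ h = 1

/-- The trivial cocycle `(1_D, 1)`. -/
def trivial (S : Type v) [SemigroupWithZero S] (D : Type w) [DivisionRing D] : TwoCocycle S D where
  α _ := 1
  ξ _ _ _ := 1
  cocycle := by simp
  twist := by simp

/-- The cocycle `(α^φ, ξ^φ)`, with `α^φ(s) = α(φ(s))` and `ξ^φ(s, t) = ξ(φ(s), φ(t))`. -/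
def comap (φ : MulAut S) (x : TwoCocycle S D) : TwoCocycle S D where
  α s := x.α (NZ.map φ s)
  ξ s t h := x.ξ (NZ.map φ s) (NZ.map φ t) (NZ.map_mul_ne_zero φ h)
  cocycle s t u hst htu h h' := by
    have h1 : (NZ.map φ s * (NZ.map φ t * NZ.map φ u) : S) ≠ 0 := by
      have := map_ne_zero φ h
      rwa [map_mul, map_mul] at this
    have h2 : (NZ.map φ s * NZ.map φ t * NZ.map φ u : S) ≠ 0 := by rwa [mul_assoc]
    have := x.cocycle (NZ.map φ s) (NZ.map φ t) (NZ.map φ u) (NZ.map_mul_ne_zero φ hst)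
      (NZ.map_mul_ne_zero φ htu) h1 h2
    simpa only [NZ.map_mul] using this
  twist s t h := by
    have := x.twist (NZ.map φ s) (NZ.map φ t) (NZ.map_mul_ne_zero φ h)
    simpa only [NZ.map_mul] using this

theorem comap_one (x : TwoCocycle S D) : x.comap 1 = x := rfl

theorem comap_mul (φ ψ : MulAut S) (x : TwoCocycle S D) :
    x.comap (φ * ψ) = (x.comap φ).comap ψ := rfl

theorem comap_trivial (φ : MulAut S) : (trivial S D).comap φ = trivial S D := rfl

variable [SquareFreeSemigroup S]

/-- The relation `(μ, η) * (α, ξ) = (β, ζ)` for `x = (α, ξ)`, `y = (β, ζ)` and `g = (μ, η)`: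
`μ_e ∘ β_s ∘ μ_f⁻¹ = ρ_{η(s)} ∘ α_s` for `s = e · s · f`, and
`μ_e(ζ(s, t)) = η(s) α_s(η(t)) ξ(s, t) η(s · t)⁻¹` for `s = e · s` and `s · t ≠ θ`. -/
def Carries (g : OneCochain S D) (x y : TwoCocycle S D) : Prop :=
  (∀ s : NZ S, g.μ (lid s) * y.α s * (g.μ (rid s))⁻¹ = inner D (g.η s) * x.α s) ∧
  ∀ (s t : NZ S) (h : (s * t : S) ≠ 0),
    g.μ (lid s) (y.ξ s t h) =
      g.η s * x.α s (g.η t) * x.ξ s t h * ((g.η (NZ.mul s t h))⁻¹ : Dˣ)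

/-- Cohomologous cocycles, `[α, ξ] = [β, ζ]`. -/
def Cohomologous (x y : TwoCocycle S D) : Prop := ∃ g : OneCochain S D, Carries g x y

theorem inner_conj (f : RingAut D) (u : Dˣ) :
    f * inner D u = inner D (Units.map (f : D →* D) u) * f := by
  ext d
  simp [← map_inv]

theorem carries_one (x : TwoCocycle S D) : Carries 1 x x := by
  refine ⟨fun s => ?_, fun s t h => ?_⟩
  · change 1 * x.α s * 1⁻¹ = inner D 1 * x.α s
    simp
  · change (x.ξ s t h : D) = (1 : Dˣ) * x.α s (1 : Dˣ) * x.ξ s t h * ((1 : Dˣ)⁻¹ : Dˣ)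
    simp

/-- `Carries` in a form without inverses. -/
theorem carries_iff (g : OneCochain S D) (x y : TwoCocycle S D) :
    Carries g x y ↔
      (∀ (s : NZ S) (d : D),
        g.μ (lid s) (y.α s d) * g.η s = g.η s * x.α s (g.μ (rid s) d)) ∧
      ∀ (s t : NZ S) (h : (s * t : S) ≠ 0),
        g.μ (lid s) (y.ξ s t h) * g.η (NZ.mul s t h) =
          g.η s * x.α s (g.η t) * x.ξ s t h := by
  refine and_congr (forall_congr' fun s => ?_) (forall_congr' fun s => forall_congr' fun t =>
    forall_congr' fun h => ?_)
  · rw [mul_inv_eq_iff_eq_mul, RingEquiv.ext_iff]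
    refine forall_congr' fun d => ?_
    simp only [RingAut.mul_apply, inner_apply]
    exact Units.eq_mul_inv_iff_mul_eq _
  · exact Units.eq_mul_inv_iff_mul_eq _

theorem Carries.mul {g g' : OneCochain S D} {x y z : TwoCocycle S D} (h : Carries g x y)
    (h' : Carries g' y z) : Carries (g * g') x z := by
  rw [carries_iff] at h h' ⊢
  refine ⟨fun s d => ?_, fun s t hst => ?_⟩
  · simp only [OneCochain.mul_μ, OneCochain.mul_η, RingAut.mul_apply, Units.val_mul,
      Units.coe_map]
    change _ * (g.μ (lid s) (g'.η s) * _) = (g.μ (lid s) (g'.η s) * _) * _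
    rw [← mul_assoc, ← map_mul, h'.1, map_mul, mul_assoc, h.1, mul_assoc]
  · simp only [OneCochain.mul_μ, OneCochain.mul_η, RingAut.mul_apply, Units.val_mul,
      Units.coe_map]
    change _ * (g.μ (lid (NZ.mul s t hst)) (g'.η _) * _) =
      (g.μ (lid s) (g'.η s) * _) * x.α s (g.μ (lid t) (g'.η t) * _) * _
    rw [lid_nzmul hst, ← mul_assoc, ← map_mul, h'.2, map_mul, map_mul, mul_assoc, h.2,
      map_mul, ← rid_eq_lid hst]
    have h1 := h.1 s (g'.η t)
    simp only [← mul_assoc]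
    rw [mul_assoc _ (g.μ (lid s) (y.α s _)), h1]
    simp only [← mul_assoc]

theorem Carries.inv {g : OneCochain S D} {x y : TwoCocycle S D} (h : Carries g x y) :
    Carries g⁻¹ y x := by
  rw [carries_iff] at h ⊢
  have hη : ∀ s, ((g⁻¹).η s : D) = (g.μ (lid s)).symm ((g.η s)⁻¹ : Dˣ) := fun s => rfl
  have hμ : ∀ e d, (g⁻¹).μ e d = (g.μ e).symm d := fun e d => rfl
  refine ⟨fun s d => ?_, fun s t hst => ?_⟩
  · rw [hη, hμ, hμ]
    apply (g.μ (lid s)).injective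
    simp only [map_mul, RingEquiv.apply_symm_apply]
    rw [Units.mul_inv_eq_iff_eq_mul, mul_assoc, h.1, RingEquiv.apply_symm_apply,
      Units.inv_mul_cancel_left]
  · simp only [hη, hμ]
    apply (g.μ (lid s)).injective
    simp only [map_mul, RingEquiv.apply_symm_apply, lid_nzmul hst]
    rw [Units.mul_inv_eq_iff_eq_mul, mul_assoc _ _ (g.η _ : D), h.2]
    have h1 := h.1 s ((g.μ (lid t)).symm ((g.η t)⁻¹ : Dˣ))
    rw [rid_eq_lid hst, RingEquiv.apply_symm_apply] at h1
    simp only [← mul_assoc]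
    rw [mul_assoc _ _ (g.η s : D), h1]
    simp only [← mul_assoc]
    rw [Units.inv_mul, one_mul, ← map_mul, Units.inv_mul, map_one, one_mul]

theorem Carries.comap {g : OneCochain S D} {x y : TwoCocycle S D} (φ : MulAut S)
    (h : Carries g x y) :
    Carries ⟨fun e => g.μ (Idem.map φ e), fun s => g.η (NZ.map φ s)⟩ (x.comap φ) (y.comap φ) := by
  refine ⟨fun s => ?_, fun s t hst => ?_⟩
  · have := h.1 (NZ.map φ s)
    rwa [lid_map, rid_map] at this
  · have := h.2 (NZ.map φ s) (NZ.map φ t) (NZ.map_mul_ne_zero φ hst)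
    rwa [lid_map, ← NZ.map_mul] at this

/-- The group `Z¹_{(α, ξ)}(S, D*)` of 1-cocycles: the stabilizer of `(α, ξ)` in
`F⁰(S, Aut D) ⋉ F¹(S, D*)`. -/
def Z1 (x : TwoCocycle S D) : Subgroup (OneCochain S D) where
  carrier := {g | Carries g x x}
  mul_mem' := Carries.mul
  one_mem' := carries_one x
  inv_mem' := Carries.inv

/-- The 1-coboundary `(e ↦ ρ_{ε(e)}, s ↦ ε(e) α_s(ε(f)⁻¹))`, `s = e · s · f`. -/
noncomputable def coboundary (x : TwoCocycle S D) : (Idem S → Dˣ) →* Z1 x where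
  toFun ε := ⟨⟨fun e => inner D (ε e),
      fun s => ε (lid s) * Units.map (x.α s : D →* D) (ε (rid s))⁻¹⟩, by
    change Carries _ x x
    rw [carries_iff]
    refine ⟨fun s d => ?_, fun s t hst => ?_⟩
    · simp [mul_assoc]
    · have h1 := congrArg (fun f => f ((ε (rid t))⁻¹ : Dˣ)) (x.twist s t hst)
      have h2 := lid_nzmul hst
      have h3 := rid_nzmul hst
      have h4 := rid_eq_lid hst
      simp only [RingAut.mul_apply, inner_apply] at h1
      have h1' : x.α s (x.α t ((ε (rid t))⁻¹ : Dˣ)) * x.ξ s t hst =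
          x.ξ s t hst * x.α (NZ.mul s t hst) ((ε (rid t))⁻¹ : Dˣ) := by
        rw [h1, mul_assoc, Units.inv_mul, mul_one]
      change (ε (lid s) * x.ξ s t hst * ((ε (lid s))⁻¹ : Dˣ) : D) *
        (ε (lid (NZ.mul s t hst)) * x.α (NZ.mul s t hst) ((ε (rid (NZ.mul s t hst)))⁻¹ : Dˣ)) =
        (ε (lid s) * x.α s ((ε (rid s))⁻¹ : Dˣ)) *
          x.α s (ε (lid t) * x.α t ((ε (rid t))⁻¹ : Dˣ)) * x.ξ s t hst
      rw [h2, h3, h4, map_mul, mul_assoc, Units.inv_mul_cancel_left, mul_assoc, ← h1']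
      have h5 : x.α s ((ε (lid t))⁻¹ : Dˣ) * x.α s (ε (lid t)) = 1 := by
        rw [← map_mul, Units.inv_mul, map_one]
      rw [mul_assoc _ (x.α s ((ε (lid t))⁻¹ : Dˣ)), ← mul_assoc (x.α s ((ε (lid t))⁻¹ : Dˣ)), h5,
        one_mul, mul_assoc]⟩
  map_one' := by
    ext s
    · simp
      rfl
    · simp
      rfl
  map_mul' ε ε' := by
    ext s
    · simp [OneCochain.mul_μ]
    · simp [OneCochain.mul_η, mul_assoc]

/-- The subgroup `B¹_{(α, ξ)}(S, D*)` of 1-coboundaries. -/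
noncomputable def B1 (x : TwoCocycle S D) : Subgroup (Z1 x) := (coboundary x).range

instance (x : TwoCocycle S D) : (B1 x).Normal where
  conj_mem := by
    rintro _ ⟨ε, rfl⟩ g
    refine ⟨fun e => Units.map (g.1.μ e : D →* D) (ε e), ?_⟩
    rw [eq_mul_inv_iff_mul_eq]
    have h := ((carries_iff _ _ _).1 g.2).1
    ext s
    · simp [coboundary, OneCochain.mul_μ]
    · have h1 := h s ((ε (rid s))⁻¹ : Dˣ)
      simp [coboundary, OneCochain.mul_η, mul_assoc] at h1 ⊢
      rw [h1]

/-- `H¹_{(α, ξ)}(S, D*) = Z¹_{(α, ξ)}(S, D*) / B¹_{(α, ξ)}(S, D*)`. -/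
abbrev H1 (x : TwoCocycle S D) : Type _ := Z1 x ⧸ B1 x

/-- `Stab_{[α, ξ]}(Aut S)`, the stabilizer of the class `[α, ξ]`. -/
def stab (x : TwoCocycle S D) : Subgroup (MulAut S) where
  carrier := {φ | Cohomologous x (x.comap φ)}
  one_mem' := ⟨1, carries_one x⟩
  mul_mem' := by
    rintro φ ψ ⟨g, hg⟩ ⟨g', hg'⟩
    exact ⟨_, hg'.mul (hg.comap ψ)⟩
  inv_mem' := by
    rintro φ ⟨g, hg⟩
    have h := (hg.comap φ⁻¹).inv
    rw [← comap_mul, mul_inv_cancel, comap_one] at h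
    exact ⟨_, h⟩

end TwoCocycle

/-! ### Twisted semigroup rings -/

/-- The twisted semigroup ring `D^α_ξ S`: the left `D`-vector space with basis `S*`, whose element
`∑ d_s s` is the finitely supported function `s ↦ d_s`. -/
def TwistedRing {S : Type v} [SemigroupWithZero S] {D : Type w} [DivisionRing D]
    (_x : TwoCocycle S D) : Type (max v w) := NZ S →₀ D

namespace TwistedRing

variable {S : Type v} [SemigroupWithZero S] {D : Type w} [DivisionRing D]

noncomputable instance (x : TwoCocycle S D) : AddCommGroup (TwistedRing x) :=
  inferInstanceAs (AddCommGroup (NZ S →₀ D))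

noncomputable instance (x : TwoCocycle S D) : Module D (TwistedRing x) :=
  inferInstanceAs (Module D (NZ S →₀ D))

/-- The element `d s` of `D^α_ξ S`. -/
noncomputable def single (x : TwoCocycle S D) (s : NZ S) : D →+ TwistedRing x :=
  Finsupp.singleAddHom s

/-- The additive map out of `D^α_ξ S` given by `d s ↦ F s d`. -/
noncomputable def lift (x : TwoCocycle S D) {M : Type*} [AddCommMonoid M] (F : NZ S → D →+ M) :
    TwistedRing x →+ M :=
  Finsupp.liftAddHom F

@[simp] theorem lift_single (x : TwoCocycle S D) {M : Type*} [AddCommMonoid M]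
    (F : NZ S → D →+ M) (s : NZ S) (d : D) : lift x F (single x s d) = F s d :=
  Finsupp.liftAddHom_apply_single F s d

theorem hom_ext {x : TwoCocycle S D} {M : Type*} [AddCommMonoid M] {f g : TwistedRing x →+ M}
    (h : ∀ s d, f (single x s d) = g (single x s d)) : f = g :=
  Finsupp.addHom_ext h

open Classical in
/-- The product of `d s` and `d' t`: it is `d α_s(d') ξ(s, t) (s · t)` if `s · t ≠ θ`, and `0`
otherwise. -/
noncomputable def mulTerm (x : TwoCocycle S D) (s t : NZ S) : D →+ D →+ TwistedRing x :=
  if h : (s * t : S) ≠ 0 then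
    AddMonoidHom.mk' (fun d => AddMonoidHom.mk'
        (fun d' => single x (NZ.mul s t h) (d * x.α s d' * x.ξ s t h))
        (fun a b => by simp [mul_add, add_mul]))
      (fun a b => by ext d'; simp [add_mul])
  else 0

theorem mulTerm_apply (x : TwoCocycle S D) {s t : NZ S} (h : (s * t : S) ≠ 0) (d d' : D) :
    mulTerm x s t d d' = single x (NZ.mul s t h) (d * x.α s d' * x.ξ s t h) := by
  simp [mulTerm, h]

theorem mulTerm_zero (x : TwoCocycle S D) {s t : NZ S} (h : (s * t : S) = 0) (d d' : D) :
    mulTerm x s t d d' = 0 := by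
  simp [mulTerm, h]

/-- The multiplication of `D^α_ξ S`: the biadditive extension of the products
`(d s) (d' t)`. -/
noncomputable def mulHom (x : TwoCocycle S D) : TwistedRing x →+ TwistedRing x →+ TwistedRing x :=
  lift x fun s => AddMonoidHom.mk' (fun d => lift x fun t => mulTerm x s t d)
    (fun a b => hom_ext fun t d' => by simp)

noncomputable instance (x : TwoCocycle S D) : Mul (TwistedRing x) := ⟨fun f g => mulHom x f g⟩

theorem mul_def (x : TwoCocycle S D) (f g : TwistedRing x) : f * g = mulHom x f g := rfl

theorem single_mul_single (x : TwoCocycle S D) (s t : NZ S) (d d' : D) :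
    single x s d * single x t d' = mulTerm x s t d d' := by
  simp [mul_def, mulHom]

theorem single_mul_single_of_ne (x : TwoCocycle S D) {s t : NZ S} (h : (s * t : S) ≠ 0)
    (d d' : D) :
    single x s d * single x t d' = single x (NZ.mul s t h) (d * x.α s d' * x.ξ s t h) := by
  rw [single_mul_single, mulTerm_apply x h]

theorem single_mul_single_of_eq (x : TwoCocycle S D) {s t : NZ S} (h : (s * t : S) = 0)
    (d d' : D) : single x s d * single x t d' = 0 := by
  rw [single_mul_single, mulTerm_zero x h]

noncomputable instance (x : TwoCocycle S D) : NonUnitalNonAssocRing (TwistedRing x) where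
  left_distrib f g h := map_add (mulHom x f) g h
  right_distrib f g h := by simp [mul_def]
  zero_mul f := by simp [mul_def]
  mul_zero f := by simp [mul_def]

theorem single_assoc (x : TwoCocycle S D) (s t u : NZ S) (a b c : D) :
    single x s a * single x t b * single x u c = single x s a * (single x t b * single x u c) := by
  by_cases h : (s * t * u : S) = 0
  · have h' : (s * (t * u) : S) = 0 := by rwa [← mul_assoc]
    trans 0
    · by_cases hst : (s * t : S) = 0
      · rw [single_mul_single_of_eq x hst, zero_mul]
      · rw [single_mul_single_of_ne x hst, single_mul_single_of_eq x h]
    · by_cases htu : (t * u : S) = 0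
      · rw [single_mul_single_of_eq x htu, mul_zero]
      · rw [single_mul_single_of_ne x htu, single_mul_single_of_eq x h']
  · have h' : (s * (t * u) : S) ≠ 0 := by rwa [← mul_assoc]
    have hst : (s * t : S) ≠ 0 := left_ne_zero_of_mul h
    have htu : (t * u : S) ≠ 0 := right_ne_zero_of_mul h'
    have e : NZ.mul (NZ.mul s t hst) u h = NZ.mul s (NZ.mul t u htu) h' :=
      Subtype.ext (mul_assoc _ _ _)
    rw [single_mul_single_of_ne x hst, single_mul_single_of_ne x htu,
      single_mul_single_of_ne x (s := NZ.mul s t hst) h,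
      single_mul_single_of_ne x (t := NZ.mul t u htu) h', e]
    congr 1
    have h1 := congrArg (fun f => f c) (x.twist s t hst)
    simp only [RingAut.mul_apply, inner_apply] at h1
    simp only [map_mul, mul_assoc]
    rw [x.cocycle s t u hst htu h' h, h1]
    simp only [mul_assoc, Units.inv_mul_cancel_left]

noncomputable instance (x : TwoCocycle S D) : NonUnitalRing (TwistedRing x) where
  mul_assoc f g h := by
    have : (AddMonoidHom.mulLeft₃ : TwistedRing x →+ _ →+ _ →+ _) = AddMonoidHom.mulRight₃ := by
      refine hom_ext fun s a => hom_ext fun t b => hom_ext fun u c => ?_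
      exact single_assoc x s t u a b c
    exact DFunLike.congr_fun (DFunLike.congr_fun (DFunLike.congr_fun this f) g) h

theorem toNZ_mul_self_ne (e : Idem S) : (e.toNZ * e.toNZ : S) ≠ 0 := by
  change (e * e : S) ≠ 0
  rw [e.2.1]
  exact e.2.2

theorem ξ_congr (x : TwoCocycle S D) {s s' t t' : NZ S} (hs : s = s') (ht : t = t')
    (h : (s * t : S) ≠ 0) (h' : (s' * t' : S) ≠ 0) : x.ξ s t h = x.ξ s' t' h' := by
  subst hs ht
  rfl

variable [SquareFreeSemigroup S]

instance : Finite (Idem S) := SquareFreeSemigroup.finite_idem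

/-- The identity element `∑ ξ(e, e)⁻¹ e`, which is `∑ e` for a normal cocycle. -/
noncomputable instance (x : TwoCocycle S D) : One (TwistedRing x) where
  one := letI := Fintype.ofFinite (Idem S)
    ∑ e : Idem S, single x e.toNZ ((x.ξ e.toNZ e.toNZ (toNZ_mul_self_ne e))⁻¹ : Dˣ)

theorem one_mul_single (x : TwoCocycle S D) (s : NZ S) (d : D) :
    1 * single x s d = single x s d := by
  let _ := Fintype.ofFinite (Idem S)
  change (∑ e : Idem S, single x e.toNZ ((x.ξ e.toNZ e.toNZ (toNZ_mul_self_ne e))⁻¹ : Dˣ)) *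
    single x s d = _
  rw [Finset.sum_mul, Finset.sum_eq_single (lid s)]
  · set e := (lid s).toNZ with he
    have hee := toNZ_mul_self_ne (lid s)
    have hl : (e * s : S) = s := lid_mul s
    have hes : (e * s : S) ≠ 0 := by rw [hl]; exact s.2
    have e1 : NZ.mul e s hes = s := Subtype.ext hl
    have e2 : NZ.mul e e hee = e := Subtype.ext (lid s).2.1
    have h1 : (e * (e * s) : S) ≠ 0 := by rwa [hl]
    have h2 : (e * e * s : S) ≠ 0 := by rwa [mul_assoc]
    have hc := x.cocycle e e s hee hes h1 h2
    rw [ξ_congr x rfl e1 h1 hes, ξ_congr x e2 rfl h2 hes] at hc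
    have hc' := mul_right_cancel₀ (Units.ne_zero _) hc
    have ht : ∀ d, x.α e d = x.ξ e e hee * d * ((x.ξ e e hee)⁻¹ : Dˣ) := by
      intro d
      have := x.twist e e hee
      rw [e2] at this
      exact congrArg (fun f => f d) (mul_right_cancel this)
    rw [ht, mul_assoc] at hc'
    have hx : (x.ξ e s hes : D) = x.ξ e e hee := by
      have h3 := mul_left_cancel₀ (Units.ne_zero _) (hc'.trans (mul_one _).symm)
      rwa [Units.mul_inv_eq_one] at h3
    rw [single_mul_single_of_ne x hes, e1, ht, hx]
    congr 1
    simp only [mul_assoc, Units.inv_mul, mul_one]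
    exact Units.inv_mul_cancel_left _ _
  · intro e _ hne
    apply single_mul_single_of_eq
    by_contra h
    exact hne (eq_lid s e h)
  · simp

theorem single_mul_one (x : TwoCocycle S D) (s : NZ S) (d : D) :
    single x s d * 1 = single x s d := by
  let _ := Fintype.ofFinite (Idem S)
  change _ * (∑ e : Idem S, single x e.toNZ
    ((x.ξ e.toNZ e.toNZ (toNZ_mul_self_ne e))⁻¹ : Dˣ)) = _
  rw [Finset.mul_sum, Finset.sum_eq_single (rid s)]
  · set f := (rid s).toNZ with hf
    have hff := toNZ_mul_self_ne (rid s)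
    have hr : (s * f : S) = s := mul_rid s
    have hsf : (s * f : S) ≠ 0 := by rw [hr]; exact s.2
    have e1 : NZ.mul s f hsf = s := Subtype.ext hr
    have e2 : NZ.mul f f hff = f := Subtype.ext (rid s).2.1
    have h2 : (s * f * f : S) ≠ 0 := by rwa [hr]
    have h1 : (s * (f * f) : S) ≠ 0 := by rwa [← mul_assoc]
    have hc := x.cocycle s f f hsf hff h1 h2
    rw [ξ_congr x rfl e2 h1 hsf, ξ_congr x e1 rfl h2 hsf] at hc
    have hc' := mul_right_cancel₀ (Units.ne_zero _) hc
    rw [single_mul_single_of_ne x hsf, e1, mul_assoc, ← hc', ← map_mul, Units.inv_mul, map_one,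
      mul_one]
  · intro e _ hne
    apply single_mul_single_of_eq
    by_contra h
    exact hne (eq_rid s e h)
  · simp

noncomputable instance (x : TwoCocycle S D) : Ring (TwistedRing x) where
  one_mul f := by
    have : AddMonoidHom.mulLeft (1 : TwistedRing x) = AddMonoidHom.id _ :=
      hom_ext fun s d => one_mul_single x s d
    exact DFunLike.congr_fun this f
  mul_one f := by
    have : AddMonoidHom.mulRight (1 : TwistedRing x) = AddMonoidHom.id _ :=
      hom_ext fun s d => single_mul_one x s d
    exact DFunLike.congr_fun this f

/-- The additive map `σ_{μ η φ}` of `D^α_ξ S` given by `d s ↦ μ_e(d) η(s) φ(s)` for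
`s = e · s`. -/
noncomputable def sigma (x : TwoCocycle S D) (g : OneCochain S D) (φ : MulAut S) :
    TwistedRing x →+ TwistedRing x :=
  lift x fun s => AddMonoidHom.mk' (fun d => single x (NZ.map φ s) (g.μ (lid s) d * g.η s))
    (fun a b => by simp [add_mul])

end TwistedRing

end SquareFree

/-! Write `idem x e` for the element 1e of D^α_ξ S. Since S is thin, the Peirce component of D^α_ξ S
at a pair of idempotents (e, f) is either 0 or a single line Ds. For e = f and a normal cocycle it
is a copy of D, so these idempotents form a complete orthogonal family whose corners are division
rings (`divCorner`).

Basicness of R makes the family pairwise inequivalent (`IsBasicRing.not_idemEquiv`). An automorphism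
γ carries it to a family of the same kind, and a Krull–Schmidt argument (`exists_unit_conj`) gives a
unit conjugating the second family back onto the first. So, modulo inner automorphisms, γ permutes
the idempotents. It then permutes the lines Ds, which makes it monomial, ds ↦ μ_e(d) η(s) φ(s): the
action on corners gives μ, the images of the basis vectors give η, and the permutation of lines
gives φ, which respects products because zero and nonzero products in S are visible in the ring
(`exists_sigma_of_map_idem`).

`Carries g x y` says that ds ↦ μ_e(d) η(s) s is multiplicative from the ring of y to the ring of x.
Hence a monomial map is multiplicative exactly when g carries `x.comap φ` to x
(`carries_of_map_mul`, `map_mul_of_carries`). The permutations φ that occur are therefore those in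
the stabilizer, and for φ = 1 the pairs are the 1-cocycles.

The remaining point is which monomial automorphisms are inner (`eq_of_inner_eq_sigma`). Conjugate
idempotents are equivalent, so φ fixes every idempotent and is 1; the conjugating unit then commutes
with all the idempotents, is diagonal, and conjugation by it is a coboundary. This makes Φ well
defined and Λ injective. If g trivializes x, the maps ds ↦ dφ(s) of the untwisted ring, conjugated
by the map of g, split the sequence. -/

namespace SquareFree

universe u v w

/-! ### Equivalent idempotents and idempotents whose corner is a division ring -/

section Idempotents

variable {R : Type*} [Ring R]

/-- Equivalence of idempotents: `e = a b` and `f = b a` with `a ∈ e R f` and `b ∈ f R e`. -/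
def IdemEquiv (e f : R) : Prop :=
  ∃ a b : R, a * b = e ∧ b * a = f ∧ e * a = a ∧ a * f = a ∧ f * b = b ∧ b * e = b

/-- A nonzero idempotent `e` for which `e R e` is a division ring. -/
structure DivCorner (e : R) : Prop where
  idem : e * e = e
  ne_zero : e ≠ 0
  exists_inv : ∀ x, e * x * e ≠ 0 →
    ∃ c, e * c = c ∧ c * e = c ∧ c * (e * x * e) = e ∧ e * x * e * c = e

theorem IdemEquiv.symm {e f : R} : IdemEquiv e f → IdemEquiv f e := by
  rintro ⟨a, b, h1, h2, h3, h4, h5, h6⟩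
  exact ⟨b, a, h2, h1, h5, h6, h3, h4⟩

theorem IdemEquiv.trans {e f g : R} : IdemEquiv e f → IdemEquiv f g → IdemEquiv e g := by
  rintro ⟨a, b, h1, h2, h3, h4, h5, h6⟩ ⟨a', b', h1', h2', h3', h4', h5', h6'⟩
  refine ⟨a * a', b' * b, ?_, ?_, ?_, ?_, ?_, ?_⟩
  · rw [mul_assoc, ← mul_assoc a', h1', h5, h1]
  · rw [mul_assoc, ← mul_assoc b, h2, h3', h2']
  · rw [← mul_assoc, h3]
  · rw [mul_assoc, h4']
  · rw [← mul_assoc, h5']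
  · rw [mul_assoc, h6]

theorem IdemEquiv.map {R' : Type*} [Ring R'] (γ : R →+* R') {e f : R} :
    IdemEquiv e f → IdemEquiv (γ e) (γ f) := by
  rintro ⟨a, b, h1, h2, h3, h4, h5, h6⟩
  exact ⟨γ a, γ b, by simp only [← map_mul, *, and_self]⟩

theorem DivCorner.map {R' : Type*} [Ring R'] (γ : R ≃+* R') {e : R} (h : DivCorner e) :
    DivCorner (γ e) where
  idem := by rw [← map_mul, h.idem]
  ne_zero := by simpa using h.ne_zero
  exists_inv x hx := by
    obtain ⟨x, rfl⟩ := γ.surjective x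
    simp only [← map_mul] at hx
    obtain ⟨c, h1, h2, h3, h4⟩ := h.exists_inv x (fun h0 => hx (by rw [h0, map_zero]))
    exact ⟨γ c, by simp only [← map_mul, *, and_self]⟩

theorem DivCorner.mul_ne_zero {e : R} (h : DivCorner e) {x y : R} (hx : e * x * e ≠ 0)
    (hy : e * y * e ≠ 0) : e * x * e * (e * y * e) ≠ 0 := by
  intro h0
  obtain ⟨c, -, -, h3, -⟩ := h.exists_inv x hx
  apply hy
  calc e * y * e = e * (e * y * e) := by simp only [← mul_assoc, h.idem]
    _ = c * (e * x * e * (e * y * e)) := by rw [← mul_assoc c, h3]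
    _ = 0 := by rw [h0, mul_zero]

theorem DivCorner.isPrimitiveIdempotent {e : R} (h : DivCorner e) : IsPrimitiveIdempotent e := by
  refine ⟨h.idem, h.ne_zero, fun f g hf hg hfg hgf he => or_iff_not_imp_left.2 fun hf0 => ?_⟩
  have hef : e * f * e = f := by
    rw [he, add_mul, hf.eq, hgf, add_zero, mul_add, hf.eq, hfg, add_zero]
  obtain ⟨c, -, -, h3, -⟩ := h.exists_inv f (by rwa [hef])
  have heg : e * g = g := by rw [he, add_mul, hfg, hg.eq, zero_add]
  rw [hef] at h3
  rw [← heg, ← h3, mul_assoc, hfg, mul_zero]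

/-- The map x ↦ a x b identifies f R f with e R e, so an inverse c found in e R e is brought back as
b c a. -/
theorem DivCorner.of_idemEquiv {e f : R} (h : DivCorner e) (hef : IdemEquiv e f) :
    DivCorner f := by
  obtain ⟨a, b, h1, h2, h3, h4, h5, h6⟩ := hef
  refine ⟨?_, ?_, fun x hx => ?_⟩
  · rw [← h2, mul_assoc, ← mul_assoc a, h1, h3]
  · rintro rfl
    exact h.ne_zero (by rw [← h1, ← h4, mul_zero, zero_mul])
  · have e1 : b * (e * (a * x * b) * e) * a = f * x * f := by
      rw [← h2]
      simp only [← mul_assoc]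
      rw [h6, mul_assoc _ e a, h3]
    obtain ⟨c, c1, c2, c3, c4⟩ := h.exists_inv (a * x * b) (by
      intro h0
      rw [h0, mul_zero, zero_mul] at e1
      exact hx e1.symm)
    refine ⟨b * c * a, ?_, ?_, ?_, ?_⟩
    · simp only [← mul_assoc, h5]
    · simp only [mul_assoc, h4]
    · rw [← e1]
      calc b * c * a * (b * (e * (a * x * b) * e) * a)
          = b * (c * (a * b) * (e * (a * x * b) * e)) * a := by simp only [mul_assoc]
        _ = f := by rw [h1, c2, c3, h6, h2]
    · rw [← e1]
      calc b * (e * (a * x * b) * e) * a * (b * c * a)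
          = b * (e * (a * x * b) * e * ((a * b) * c)) * a := by simp only [mul_assoc]
        _ = f := by rw [h1, c1, c4, h6, h2]

/-- If `e R e` is a division ring, `f` is primitive and `e R f R e ≠ 0`, then `e` and `f` are
equivalent. -/
theorem DivCorner.idemEquiv {e f : R} (h : DivCorner e) (hf : IsPrimitiveIdempotent f) {x y : R}
    (hne : e * (x * f * y) * e ≠ 0) : IdemEquiv e f := by
  obtain ⟨c, c1, c2, c3, c4⟩ := h.exists_inv _ hne
  have hff : f * f = f := hf.1
  set a := e * x * f with ha
  set b := f * y * e * c with hb
  have hab : a * b = e := by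
    calc a * b = e * x * (f * f) * y * e * c := by simp only [ha, hb, mul_assoc]
      _ = e * (x * f * y) * e * c := by rw [hff]; simp only [mul_assoc]
      _ = e := c4
  have hea : e * a = a := by simp only [ha, ← mul_assoc, h.idem]
  have haf : a * f = a := by simp only [ha, mul_assoc, hff]
  have hfb : f * b = b := by simp only [hb, ← mul_assoc, hff]
  have hbe : b * e = b := by simp only [hb, mul_assoc, c2]
  have hg : b * a * (b * a) = b * a := by rw [mul_assoc, ← mul_assoc a, hab, hea]
  have hfg : f * (b * a) = b * a := by rw [← mul_assoc, hfb]
  have hgf : b * a * f = b * a := by rw [mul_assoc, haf]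
  refine ⟨a, b, hab, ?_, hea, haf, hfb, hbe⟩
  -- b a is an idempotent in f R f, and primitivity of f is applied to the splitting f = b a + (f -
  -- b a). The case b a = 0 would give e = a (b a) b = 0.
  rcases hf.2.2 (b * a) (f - b * a) hg (by
      change (f - b * a) * (f - b * a) = f - b * a
      rw [mul_sub, sub_mul, sub_mul, hff, hfg, hgf, hg]; abel) (by rw [mul_sub, hgf, hg, sub_self])
      (by rw [sub_mul, hfg, hg, sub_self]) (by abel) with h0 | h0
  · refine absurd ?_ h.ne_zero
    calc e = a * b * (a * b) := by rw [hab, h.idem]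
      _ = a * (b * a) * b := by simp only [mul_assoc]
      _ = 0 := by rw [h0, mul_zero, zero_mul]
  · exact (sub_eq_zero.1 h0).symm

/-- Right multiplications by a and by b are mutually inverse between R e and R f. This links
equivalence to the module isomorphisms in the definition of a basic ring. -/
theorem IdemEquiv.nonempty_linearEquiv {e f : R} (h : IdemEquiv e f) :
    Nonempty (Submodule.span R {e} ≃ₗ[R] Submodule.span R {f}) := by
  obtain ⟨a, b, h1, h2, h3, h4, h5, h6⟩ := h
  have key : ∀ {a e f : R}, a * f = a → ∀ x ∈ Submodule.span R {e},
      LinearMap.toSpanSingleton R R a x ∈ Submodule.span R {f} := by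
    intro a e f h x _
    refine Submodule.mem_span_singleton.2 ⟨x * a, ?_⟩
    rw [smul_eq_mul, mul_assoc, h, LinearMap.toSpanSingleton_apply, smul_eq_mul]
  refine ⟨LinearEquiv.ofLinearMap ((LinearMap.toSpanSingleton R R a).restrict (key h4))
    ((LinearMap.toSpanSingleton R R b).restrict (key h6)) ?_ ?_⟩
  · ext ⟨y, hy⟩
    obtain ⟨z, rfl⟩ := Submodule.mem_span_singleton.1 hy
    have : b * a * (b * a) = b * a := by rw [mul_assoc, ← mul_assoc a, h1, h3]
    simp [mul_assoc, ← h2] at this ⊢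
    rw [this]
  · ext ⟨y, hy⟩
    obtain ⟨z, rfl⟩ := Submodule.mem_span_singleton.1 hy
    have : a * b * (a * b) = a * b := by rw [mul_assoc, ← mul_assoc b, h2, h5]
    simp [mul_assoc, ← h1] at this ⊢
    rw [this]

theorem exists_mul_mul_ne_zero {I : Type*} [Fintype I] {e : I → R} (he : ∑ i, e i = 1) {x y : R}
    (h : x * y ≠ 0) : ∃ i, x * e i * y ≠ 0 := by
  by_contra! h0
  apply h
  rw [← mul_one x, ← he, Finset.mul_sum, Finset.sum_mul]
  exact Finset.sum_eq_zero fun i _ => h0 i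

/-- In a basic ring, orthogonal idempotents whose corners are division rings are not equivalent. -/
theorem IsBasicRing.not_idemEquiv (hR : IsBasicRing R) {e f : R} (he : DivCorner e)
    (hef : e * f = 0) (h : IdemEquiv e f) : False := by
  obtain ⟨n, p, hp, hprim, hiso⟩ := hR
  obtain ⟨i, hi⟩ := exists_mul_mul_ne_zero hp.complete (x := e) (y := e) (he.idem.symm ▸ he.ne_zero)
  have hei : IdemEquiv e (p i) :=
    he.idemEquiv (hprim i) (x := 1) (y := 1) (by simpa using hi)
  set g := p i with hgdef
  have hg : DivCorner g := he.of_idemEquiv hei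
  -- Compression to the division ring g R g is multiplicative on all of R: a nonzero contribution of
  -- some p j with j ≠ i would make g equivalent to p j, against basicness.
  have hmul : ∀ x y, g * x * g * (g * y * g) = g * (x * y) * g := by
    intro x y
    have hz : ∀ j, j ≠ i → g * (x * p j * y) * g = 0 := by
      intro j hj
      by_contra hne
      exact hj (hiso i j (hg.idemEquiv (hprim j) hne).nonempty_linearEquiv).symm
    have : g * (x * y) * g = ∑ j, g * (x * p j * y) * g := by
      rw [← Finset.sum_mul, ← Finset.mul_sum, ← Finset.sum_mul, ← Finset.mul_sum, hp.complete,
        mul_one]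
    rw [this, Finset.sum_eq_single i (fun j _ hj => hz j hj) (by simp)]
    calc g * x * g * (g * y * g) = g * (x * (g * g) * y) * g := by simp only [mul_assoc]
      _ = _ := by rw [hg.idem]
  obtain ⟨a, b, h1, h2, -, -, -, -⟩ := h
  obtain ⟨q, r, k1, k2, k3, -, -, -⟩ := hei
  have ge : g * e * g ≠ 0 := by
    intro h0
    have h3 : g * (r * e * q) * g = 0 := by
      rw [← hmul, ← hmul, h0, mul_zero, zero_mul]
    rw [mul_assoc r, k3, k2, hg.idem, hg.idem] at h3
    exact hg.ne_zero h3
  have gf : g * f * g ≠ 0 := by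
    intro h0
    apply hg.mul_ne_zero ge ge
    have h3 : e * e = a * f * b := by
      rw [← h1, ← h2]
      simp only [mul_assoc]
    rw [hmul, h3, ← hmul, ← hmul, h0, mul_zero, zero_mul]
  -- The orthogonal idempotents e and f both have nonzero image in g R g, which has no zero
  -- divisors.
  apply hg.mul_ne_zero ge gf
  rw [hmul, hef, mul_zero, zero_mul]

/-- Two complete families of orthogonal, pairwise inequivalent idempotents whose corners are
division rings are conjugate up to a permutation. -/
theorem exists_unit_conj {I : Type*} [Fintype I] {e e' : I → R}
    (he : CompleteOrthogonalIdempotents e) (he' : CompleteOrthogonalIdempotents e')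
    (hd : ∀ i, DivCorner (e i)) (hd' : ∀ i, DivCorner (e' i))
    (hne' : ∀ i j, IdemEquiv (e' i) (e' j) → i = j) :
    ∃ (u : Rˣ) (σ : I → I), ∀ i, u * e' i * (u⁻¹ : Rˣ) = e (σ i) := by
  have h : ∀ i, ∃ j, IdemEquiv (e' i) (e j) := by
    intro i
    obtain ⟨j, hj⟩ := exists_mul_mul_ne_zero he.complete (x := e' i) (y := e' i)
      ((hd' i).idem.symm ▸ (hd' i).ne_zero)
    exact ⟨j, (hd' i).idemEquiv (hd j).isPrimitiveIdempotent (x := 1) (y := 1) (by simpa using hj)⟩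
  choose σ hσ using h
  have hinj : Function.Injective σ := fun i j hij =>
    hne' i j ((hσ i).trans (hij ▸ (hσ j).symm))
  -- Two indices with the same value of σ would make two members of e' equivalent; finiteness of the
  -- index set turns injectivity into bijectivity.
  have hbij : Function.Bijective σ := Finite.injective_iff_bijective.1 hinj
  choose q p h1 h2 h3 h4 h5 h6 using hσ
  have hpq : ∀ i j, i ≠ j → p i * q j = 0 := fun i j hij => by
    rw [← h6 i, ← h3 j, mul_assoc, ← mul_assoc (e' i), he'.ortho hij, zero_mul, mul_zero]
  have hqp : ∀ i j, i ≠ j → q i * p j = 0 := fun i j hij => by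
    rw [← h4 i, ← h5 j, mul_assoc, ← mul_assoc (e (σ i)), he.ortho (hinj.ne hij), zero_mul,
      mul_zero]
  have s1 : (∑ i, p i) * ∑ i, q i = 1 := by
    rw [Finset.sum_mul_sum, ← he.complete, ← hbij.sum_comp e]
    refine Finset.sum_congr rfl fun i _ => ?_
    rw [Finset.sum_eq_single i (fun j _ hj => hpq i j hj.symm) (by simp), h2]
  have s2 : (∑ i, q i) * ∑ i, p i = 1 := by
    rw [Finset.sum_mul_sum, ← he'.complete]
    refine Finset.sum_congr rfl fun i _ => ?_
    rw [Finset.sum_eq_single i (fun j _ hj => hqp i j hj.symm) (by simp), h1]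
  -- The local equivalences p i, from e' i to e (σ i), add up to one unit because all cross terms
  -- vanish by orthogonality.
  refine ⟨⟨∑ i, p i, ∑ i, q i, s1, s2⟩, σ, fun i => ?_⟩
  change (∑ i, p i) * e' i * (∑ i, q i) = _
  have t1 : (∑ i, p i) * e' i = p i := by
    rw [Finset.sum_mul, Finset.sum_eq_single i (fun j _ hj => ?_) (by simp), h6]
    rw [← h6 j, mul_assoc, he'.ortho hj, mul_zero]
  rw [t1, Finset.mul_sum, Finset.sum_eq_single i (fun j _ hj => hpq i j hj.symm) (by simp), h2]

end Idempotents

/-! ### Pieces of a twisted semigroup ring -/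

section Semigroup

variable {S : Type v} [SemigroupWithZero S] [SquareFreeSemigroup S]

/-- This is thinness of S: the two idempotents are coordinates on S*. Finiteness of S* and the
uniqueness of φ rest on it. -/
theorem NZ.ext_lid_rid {s t : NZ S} (hl : lid s = lid t) (hr : rid s = rid t) : s = t :=
  Subtype.ext <| SquareFreeSemigroup.thin (lid s) (rid s)
    ⟨⟨s, (lid_mul_mul_rid s).symm⟩, s.2⟩ ⟨⟨t, by rw [hl, hr, lid_mul_mul_rid]⟩, t.2⟩

theorem Idem.toNZ_injective : Function.Injective (Idem.toNZ : Idem S → NZ S) := fun e f h => by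
  rw [← lid_toNZ e, h, lid_toNZ]

omit [SquareFreeSemigroup S] in
theorem NZ.map_toNZ (φ : MulAut S) (e : Idem S) : NZ.map φ e.toNZ = (Idem.map φ e).toNZ := rfl

instance : Finite (NZ S) :=
  Finite.of_injective (fun s : NZ S => (lid s, rid s)) fun s t h => by
    simp only [Prod.mk.injEq] at h
    exact NZ.ext_lid_rid h.1 h.2

noncomputable instance : Fintype (Idem S) := Fintype.ofFinite _

theorem MulAut.eq_one_of_idem_map {φ : MulAut S} (h : ∀ e, Idem.map φ e = e) : φ = 1 := by
  ext s
  by_cases hs : s = 0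
  · by_contra h0
    have := map_ne_zero φ⁻¹ (s := φ s) (by rwa [hs] at h0 ⊢)
    exact this ((φ.symm_apply_apply s).trans hs)
  · exact congrArg Subtype.val (NZ.ext_lid_rid (s := NZ.map φ ⟨s, hs⟩) (t := ⟨s, hs⟩)
      (by rw [lid_map, h]) (by rw [rid_map, h]))

end Semigroup

namespace TwistedRing

variable {S : Type v} [SemigroupWithZero S] [SquareFreeSemigroup S] {D : Type w} [DivisionRing D]
  {x : TwoCocycle S D}

omit [SquareFreeSemigroup S] in
theorem single_injective (x : TwoCocycle S D) (s : NZ S) : Function.Injective (single x s) :=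
  Finsupp.single_injective s

theorem single_ne_zero (x : TwoCocycle S D) (s : NZ S) {d : D} (h : d ≠ 0) : single x s d ≠ 0 :=
  Finsupp.single_ne_zero.2 h

omit [SquareFreeSemigroup S] in
theorem eq_of_single_eq {s t : NZ S} {d d' : D} (hd : d ≠ 0) (h : single x s d = single x t d') :
    s = t ∧ d = d' := by
  rcases (Finsupp.single_eq_single_iff s t d d').1 h with h | h
  · exact h
  · exact absurd h.1 hd

/-- The coefficient of `s` in an element of `D^α_ξ S`. -/
noncomputable def coeff (x : TwoCocycle S D) (s : NZ S) : TwistedRing x →+ D :=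
  Finsupp.applyAddHom s

@[simp] theorem coeff_single (s : NZ S) (d : D) : coeff x s (single x s d) = d :=
  Finsupp.single_eq_same

theorem coeff_single_of_ne {s t : NZ S} (h : s ≠ t) (d : D) : coeff x t (single x s d) = 0 :=
  Finsupp.single_eq_of_ne h.symm

/-- The element `1 e` of `D^α_ξ S`. -/
noncomputable def idem (x : TwoCocycle S D) (e : Idem S) : TwistedRing x := single x e.toNZ 1

theorem one_eq_sum (x : TwoCocycle S D) : (1 : TwistedRing x) =
    ∑ e : Idem S, single x e.toNZ ((x.ξ e.toNZ e.toNZ (toNZ_mul_self_ne e))⁻¹ : Dˣ) := rfl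

theorem toNZ_nzmul {s : NZ S} (h : ((lid s).toNZ * s : S) ≠ 0) : NZ.mul (lid s).toNZ s h = s :=
  Subtype.ext (lid_mul s)

theorem nzmul_toNZ {s : NZ S} (h : (s * (rid s).toNZ : S) ≠ 0) : NZ.mul s (rid s).toNZ h = s :=
  Subtype.ext (mul_rid s)

section Normal

variable (hx : x.IsNormal)
include hx

theorem one_eq : (1 : TwistedRing x) = ∑ e : Idem S, idem x e := by
  rw [one_eq_sum]
  refine Finset.sum_congr rfl fun e _ => ?_
  rw [(hx e).2]
  simp [idem]

omit hx in
theorem idem_mul_single_of_ne {e : Idem S} {s : NZ S} (h : e ≠ lid s) (d : D) :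
    idem x e * single x s d = 0 := by
  apply single_mul_single_of_eq
  by_contra h0
  exact h (eq_lid s e h0)

omit hx in
theorem single_mul_idem_of_ne {e : Idem S} {s : NZ S} (h : e ≠ rid s) (d : D) :
    single x s d * idem x e = 0 := by
  apply single_mul_single_of_eq
  by_contra h0
  exact h (eq_rid s e h0)

theorem idem_mul_single (s : NZ S) (d : D) : idem x (lid s) * single x s d = single x s d := by
  conv_rhs => rw [← one_mul (single x s d), one_eq hx, Finset.sum_mul]
  rw [Finset.sum_eq_single (lid s) (fun e _ h => idem_mul_single_of_ne h d) (by simp)]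

theorem single_mul_idem (s : NZ S) (d : D) : single x s d * idem x (rid s) = single x s d := by
  conv_rhs => rw [← mul_one (single x s d), one_eq hx, Finset.mul_sum]
  rw [Finset.sum_eq_single (rid s) (fun e _ h => single_mul_idem_of_ne h d) (by simp)]

/-- Normality prescribes ξ only at the pairs (e, e). The other values at idempotents are read off
from 1 = ∑ e acting as the identity. -/
theorem ξ_rid (s : NZ S) (h : (s * (rid s).toNZ : S) ≠ 0) : x.ξ s (rid s).toNZ h = 1 := by
  have h1 := single_mul_idem hx s 1
  rw [idem, single_mul_single_of_ne x h, nzmul_toNZ] at h1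
  have := single_injective x s h1
  simpa using this

theorem ξ_lid (s : NZ S) (h : ((lid s).toNZ * s : S) ≠ 0) : x.ξ (lid s).toNZ s h = 1 := by
  have h1 := idem_mul_single hx s 1
  rw [idem, single_mul_single_of_ne x h, toNZ_nzmul] at h1
  have := single_injective x s h1
  simpa using this

theorem single_lid_mul_single (s : NZ S) (d d' : D) :
    single x (lid s).toNZ d * single x s d' = single x s (d * d') := by
  have h : ((lid s).toNZ * s : S) ≠ 0 := by
    change (lid s * s : S) ≠ 0
    rw [lid_mul]; exact s.2
  rw [single_mul_single_of_ne x h, toNZ_nzmul, ξ_lid hx, (hx (lid s)).1]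
  simp

theorem single_mul_single_rid (s : NZ S) (d d' : D) :
    single x s d * single x (rid s).toNZ d' = single x s (d * x.α s d') := by
  have h : (s * (rid s).toNZ : S) ≠ 0 := by
    change (s * rid s : S) ≠ 0
    rw [mul_rid]; exact s.2
  rw [single_mul_single_of_ne x h, nzmul_toNZ, ξ_rid hx]
  simp

theorem single_toNZ_mul (e : Idem S) (d d' : D) :
    single x e.toNZ d * single x e.toNZ d' = single x e.toNZ (d * d') := by
  have := single_lid_mul_single hx e.toNZ d d'
  rwa [lid_toNZ] at this

theorem completeOrthogonalIdempotents : CompleteOrthogonalIdempotents (idem x) where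
  idem e := by
    change idem x e * idem x e = idem x e
    rw [idem, single_toNZ_mul hx, one_mul]
  ortho e f h := by
    change idem x e * idem x f = 0
    exact idem_mul_single_of_ne (by rwa [lid_toNZ]) _
  complete := (one_eq hx).symm

/-- A basis element other than s differs from s in its left or its right idempotent, and is killed
on that side. -/
theorem idem_mul_mul_idem (t : TwistedRing x) (s : NZ S) :
    idem x (lid s) * t * idem x (rid s) = single x s (coeff x s t) := by
  have : (AddMonoidHom.mulRight (idem x (rid s))).comp (AddMonoidHom.mulLeft (idem x (lid s))) =
      (single x s).comp (coeff x s) := by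
    refine hom_ext fun s' d => ?_
    simp only [AddMonoidHom.comp_apply, AddMonoidHom.coe_mulLeft, AddMonoidHom.coe_mulRight]
    by_cases h : s' = s
    · subst h
      rw [idem_mul_single hx, single_mul_idem hx, coeff_single]
    · rw [coeff_single_of_ne h, map_zero]
      by_cases hl : lid s = lid s'
      · rw [hl, idem_mul_single hx]
        exact single_mul_idem_of_ne (fun hr => h (NZ.ext_lid_rid hl.symm hr.symm)) d
      · rw [idem_mul_single_of_ne hl, zero_mul]
  exact DFunLike.congr_fun this t

omit hx in
theorem idem_mul_mul_idem_eq_zero {e f : Idem S} (h : ∀ s : NZ S, lid s = e → rid s ≠ f)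
    (hx : x.IsNormal) (t : TwistedRing x) : idem x e * t * idem x f = 0 := by
  have : (AddMonoidHom.mulRight (idem x f)).comp (AddMonoidHom.mulLeft (idem x e)) = 0 := by
    refine hom_ext fun s d => ?_
    simp only [AddMonoidHom.comp_apply, AddMonoidHom.coe_mulLeft, AddMonoidHom.coe_mulRight]
    by_cases hl : e = lid s
    · rw [hl, idem_mul_single hx]
      exact single_mul_idem_of_ne (Ne.symm (h s hl.symm)) d
    · rw [idem_mul_single_of_ne hl, zero_mul]
      rfl
  exact DFunLike.congr_fun this t

theorem idem_mul_mul_self (t : TwistedRing x) (e : Idem S) :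
    idem x e * t * idem x e = single x e.toNZ (coeff x e.toNZ t) := by
  have := idem_mul_mul_idem hx t e.toNZ
  rwa [lid_toNZ, rid_toNZ] at this

/-- The corner at e is the line De, and normality makes its multiplication that of D. -/
theorem divCorner (e : Idem S) : DivCorner (idem x e) where
  idem := (completeOrthogonalIdempotents hx).idem e
  ne_zero := single_ne_zero x _ one_ne_zero
  exists_inv t ht := by
    rw [idem_mul_mul_self hx] at ht ⊢
    set d := coeff x e.toNZ t
    have hd : d ≠ 0 := by
      intro h0
      rw [h0, map_zero] at ht
      exact ht rfl
    refine ⟨single x e.toNZ d⁻¹, ?_⟩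
    simp [idem, single_toNZ_mul hx, hd]

omit hx in
theorem idem_injective : Function.Injective (idem x) := fun _ _ h =>
  Idem.toNZ_injective (eq_of_single_eq one_ne_zero h).1

end Normal

/-! ### The maps `d s ↦ μ_e(d) η(s) φ(s)` -/

@[simp] theorem sigma_single (x : TwoCocycle S D) (g : OneCochain S D) (φ : MulAut S) (s : NZ S)
    (d : D) : sigma x g φ (single x s d) = single x (NZ.map φ s) (g.μ (lid s) d * g.η s) := by
  simp [sigma]

/-- The pair `(μ ∘ φ, η ∘ φ)`. -/
def _root_.SquareFree.OneCochain.comap (φ : MulAut S) (g : OneCochain S D) : OneCochain S D :=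
  ⟨fun e => g.μ (Idem.map φ e), fun s => g.η (NZ.map φ s)⟩

theorem _root_.SquareFree.OneCochain.mul_comap (φ : MulAut S) (g g' : OneCochain S D) :
    (g * g').comap φ = g.comap φ * g'.comap φ := by
  ext s
  · rfl
  · simp [OneCochain.comap, OneCochain.mul_η, lid_map]

omit [SquareFreeSemigroup S] in
theorem _root_.SquareFree.OneCochain.one_comap (φ : MulAut S) :
    (1 : OneCochain S D).comap φ = 1 := rfl

/-- The inner map moves s to φ'(s) before the outer pair is evaluated, which is why g enters pulled
back along φ'. -/
theorem sigma_sigma (x : TwoCocycle S D) (g g' : OneCochain S D) (φ φ' : MulAut S)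
    (t : TwistedRing x) :
    sigma x g φ (sigma x g' φ' t) = sigma x (g.comap φ' * g') (φ * φ') t := by
  have : (sigma x g φ).comp (sigma x g' φ') = sigma x (g.comap φ' * g') (φ * φ') := by
    refine hom_ext fun s d => ?_
    simp only [AddMonoidHom.comp_apply, sigma_single, map_mul, OneCochain.mul_η,
      OneCochain.mul_μ, Units.val_mul, RingAut.mul_apply, lid_map, OneCochain.comap,
      Units.coe_map, MonoidHom.coe_coe, mul_assoc]
    rfl
  exact DFunLike.congr_fun this t

theorem sigma_one_one (x : TwoCocycle S D) (t : TwistedRing x) : sigma x 1 1 t = t := by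
  have : sigma x 1 1 = AddMonoidHom.id _ := by
    refine hom_ext fun s d => ?_
    rw [sigma_single]
    change single x s (d * ((1 : Dˣ) : D)) = single x s d
    simp
  exact DFunLike.congr_fun this t

theorem sigma_injective (x : TwoCocycle S D) {g g' : OneCochain S D} {φ φ' : MulAut S}
    (h : ∀ s d, sigma x g φ (single x s d) = sigma x g' φ' (single x s d))
    (hη : ∀ e : Idem S, g.η e.toNZ = g'.η e.toNZ) : g = g' := by
  have h1 : ∀ s d, g.μ (lid s) d * g.η s = g'.μ (lid s) d * g'.η s := by
    intro s d
    by_cases hd : d = 0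
    · simp [hd]
    · have := h s d
      rw [sigma_single, sigma_single] at this
      exact (eq_of_single_eq (by simp [hd]) this).2
  ext s
  · rename_i d
    have := h1 s.toNZ d
    rw [hη, lid_toNZ] at this
    exact mul_right_cancel₀ (Units.ne_zero _) this
  · simpa using h1 s 1

/-- The image η(e) φ(e) of an idempotent is idempotent, and the only nonzero idempotent of D is 1.
-/
theorem η_toNZ_of_map_mul (hx : x.IsNormal) {g : OneCochain S D} {φ : MulAut S}
    (h : ∀ a b, sigma x g φ (a * b) = sigma x g φ a * sigma x g φ b) (e : Idem S) :
    g.η e.toNZ = 1 := by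
  have h1 := h (idem x e) (idem x e)
  rw [idem, single_toNZ_mul hx, sigma_single, sigma_single, NZ.map_toNZ, single_toNZ_mul hx,
    one_mul, map_one, one_mul] at h1
  have h2 := single_injective x _ h1
  exact Units.ext ((mul_eq_left₀ (Units.ne_zero _)).1 h2.symm)

/-- The two conditions are multiplicativity tested on the products of 1s with df, where f is the
right idempotent of s, and of 1s with 1t. The first needs η(f) = 1. -/
theorem carries_of_map_mul (hx : x.IsNormal) {g : OneCochain S D} {φ : MulAut S}
    (h : ∀ a b, sigma x g φ (a * b) = sigma x g φ a * sigma x g φ b) :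
    TwoCocycle.Carries g (x.comap φ) x := by
  have key : ∀ (s t : NZ S) (hst : (s * t : S) ≠ 0) (d : D),
      g.μ (lid s) (x.α s d * x.ξ s t hst) * g.η (NZ.mul s t hst) =
      g.η s * x.α (NZ.map φ s) (g.μ (lid t) d * g.η t) * (x.comap φ).ξ s t hst := by
    intro s t hst d
    have h1 := h (single x s 1) (single x t d)
    rw [single_mul_single_of_ne x hst, sigma_single, sigma_single, sigma_single,
      single_mul_single_of_ne x (NZ.map_mul_ne_zero φ hst), ← NZ.map_mul (h := hst),
      lid_nzmul hst, one_mul, map_one, one_mul] at h1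
    exact single_injective x _ h1
  have hη := η_toNZ_of_map_mul hx h
  rw [TwoCocycle.carries_iff]
  refine ⟨fun s d => ?_, fun s t hst => ?_⟩
  · have h1 := h (single x s 1) (single x (rid s).toNZ d)
    rw [single_mul_single_rid hx, sigma_single, sigma_single, sigma_single, NZ.map_toNZ,
      ← rid_map, single_mul_single_rid hx, lid_toNZ, hη, Units.val_one] at h1
    have h2 := single_injective x _ h1
    simpa [TwoCocycle.comap] using h2
  · simpa [TwoCocycle.comap] using key s t hst 1

theorem map_mul_of_carries {g : OneCochain S D} {φ : MulAut S}
    (h : TwoCocycle.Carries g (x.comap φ) x) (a b : TwistedRing x) :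
    sigma x g φ (a * b) = sigma x g φ a * sigma x g φ b := by
  have : ((AddMonoidHom.mul : TwistedRing x →+ _).compr₂ (sigma x g φ)) =
      (AddMonoidHom.mul.compl₂ (sigma x g φ)).comp (sigma x g φ) := by
    refine hom_ext fun s d => hom_ext fun t d' => ?_
    change sigma x g φ (single x s d * single x t d') =
      sigma x g φ (single x s d) * sigma x g φ (single x t d')
    rw [TwoCocycle.carries_iff] at h
    rw [sigma_single, sigma_single]
    by_cases hst : (s * t : S) = 0
    · rw [single_mul_single_of_eq x hst, map_zero, single_mul_single_of_eq]
      by_contra h0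
      -- A nonzero product φ(s)φ(t) would pull back along φ⁻¹ to a nonzero product st.
      have := NZ.map_mul_ne_zero φ⁻¹ (s := NZ.map φ s) (t := NZ.map φ t) h0
      apply this
      simpa [NZ.map] using hst
    · rw [single_mul_single_of_ne x hst, single_mul_single_of_ne x (NZ.map_mul_ne_zero φ hst),
        ← NZ.map_mul (h := hst), sigma_single]
      congr 1
      have h1 := h.1 s d'
      have h2 := h.2 s t hst
      rw [← rid_eq_lid hst, lid_nzmul hst, map_mul, map_mul, mul_assoc, h2, map_mul]
      simp only [← mul_assoc]
      rw [mul_assoc _ _ (g.η s : D), h1]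
      simp only [← mul_assoc]
      rfl
  exact DFunLike.congr_fun (DFunLike.congr_fun this a) b

/-! ### Automorphisms permuting the idempotents are monomial -/

/-- An automorphism that sends each `1 s` to a multiple of `φ₀ s` determines an automorphism
of `S`. -/
theorem exists_mulAut {γ : RingAut (TwistedRing x)} {φ₀ : NZ S → NZ S} {k : NZ S → D}
    (hγ : ∀ s, γ (single x s 1) = single x (φ₀ s) (k s)) (hk : ∀ s, k s ≠ 0)
    (hd : ∀ s d, ∃ d', γ (single x s d) = single x (φ₀ s) d')
    (hinj : Function.Injective φ₀) : ∃ φ : MulAut S, ∀ s, NZ.map φ s = φ₀ s := by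
  classical
  have hbij : Function.Bijective φ₀ := Finite.injective_iff_bijective.1 hinj
  let f : S → S := fun s => if h : s = 0 then 0 else φ₀ ⟨s, h⟩
  have f0 : f 0 = 0 := by simp [f]
  have fs : ∀ s : NZ S, f s = φ₀ s := fun s => by simp [f, s.2]
  have hprod : ∀ s t : NZ S, single x (φ₀ s) (k s) * single x (φ₀ t) (k t) =
      γ (single x s 1 * single x t 1) := fun s t => by rw [map_mul, hγ, hγ]
  -- A product of nonzero multiples of s and t vanishes exactly when st = θ, and is otherwise a
  -- nonzero multiple of st. Applying γ transports this to φ₀ s and φ₀ t.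
  have fmul : ∀ s t, f (s * t) = f s * f t := by
    intro s t
    by_cases hs : s = 0
    · simp [hs, f0]
    by_cases ht : t = 0
    · simp [ht, f0]
    lift s to NZ S using hs
    lift t to NZ S using ht
    have h := hprod s t
    rw [fs, fs]
    by_cases hst : (s * t : S) = 0
    · rw [hst, f0]
      by_contra h0
      rw [single_mul_single_of_ne x (Ne.symm h0), single_mul_single_of_eq x hst, map_zero] at h
      exact single_ne_zero x _ (by simp [hk]) h
    · rw [single_mul_single_of_ne x hst] at h
      -- γ need not be D-linear, so the image of a multiple of st is controlled by `hd` and not by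
      -- `hγ`.
      obtain ⟨d', hd'⟩ := hd (NZ.mul s t hst) (1 * x.α s 1 * x.ξ s t hst)
      have hd0 : d' ≠ 0 := by
        rintro rfl
        rw [map_zero, map_eq_zero_iff γ γ.injective] at hd'
        exact single_ne_zero x _ (by simp) hd'
      rw [hd'] at h
      have h0 : (φ₀ s * φ₀ t : S) ≠ 0 := by
        intro h0
        rw [single_mul_single_of_eq x h0] at h
        exact single_ne_zero x _ hd0 h.symm
      rw [single_mul_single_of_ne x h0] at h
      have h1 := (eq_of_single_eq hd0 h.symm).1
      exact (fs (NZ.mul s t hst)).trans (congrArg Subtype.val h1)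
  have fne : ∀ s, s ≠ 0 → f s ≠ 0 := fun s hs => by
    have := fs ⟨s, hs⟩
    rw [this]
    exact (φ₀ _).2
  have fbij : Function.Bijective f := by
    constructor
    · intro s t h
      by_cases hs : s = 0
      · by_contra hst
        exact fne t (fun ht => hst (hs.trans ht.symm)) (by rw [← h, hs, f0])
      · have ht : t ≠ 0 := fun ht => fne s hs (by rw [h, ht, f0])
        lift s to NZ S using hs
        lift t to NZ S using ht
        rw [fs, fs] at h
        rw [hinj (Subtype.ext h)]
    · intro t
      by_cases ht : t = 0
      · exact ⟨0, by rw [f0, ht]⟩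
      · obtain ⟨s, hs⟩ := hbij.2 ⟨t, ht⟩
        exact ⟨s, by rw [fs, hs]⟩
  exact ⟨MulEquiv.ofBijective (MulHom.mk f fmul) fbij, fun s => Subtype.ext (fs s)⟩

/-- An automorphism permuting the idempotents of `S` has the form `d s ↦ μ_e(d) η(s) φ(s)`. -/
theorem exists_sigma_of_map_idem (hx : x.IsNormal) (γ : RingAut (TwistedRing x))
    {σ : Idem S → Idem S} (hσ : ∀ e, γ (idem x e) = idem x (σ e)) :
    ∃ (g : OneCochain S D) (φ : MulAut S), ∀ t, γ t = sigma x g φ t := by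
  have hσinj : Function.Injective σ := fun e f h =>
    idem_injective (x := x) (γ.injective (by rw [hσ, hσ, h]))
  have hcorner : ∀ s d, γ (single x s d) =
      idem x (σ (lid s)) * γ (single x s d) * idem x (σ (rid s)) := by
    intro s d
    rw [← hσ, ← hσ, ← map_mul, ← map_mul, idem_mul_single hx, single_mul_idem hx]
  -- The nonzero element γ(1s) lies in the Peirce component at (σ(e), σ(f)), so that component
  -- contains an element of S*.
  have hex : ∀ s : NZ S, ∃ s' : NZ S, lid s' = σ (lid s) ∧ rid s' = σ (rid s) := by
    intro s
    by_contra! h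
    have h1 := hcorner s 1
    rw [idem_mul_mul_idem_eq_zero h hx, map_eq_zero_iff γ γ.injective] at h1
    exact single_ne_zero x s one_ne_zero h1
  choose φ₀ hl hr using hex
  have hγ : ∀ s d, γ (single x s d) = single x (φ₀ s) (coeff x (φ₀ s) (γ (single x s d))) := by
    intro s d
    conv_lhs => rw [hcorner, ← hl, ← hr, idem_mul_mul_idem hx]
  have hinj : Function.Injective φ₀ := fun s t h =>
    NZ.ext_lid_rid (hσinj (by rw [← hl, h, hl])) (hσinj (by rw [← hr, h, hr]))
  have hk : ∀ s, coeff x (φ₀ s) (γ (single x s 1)) ≠ 0 := by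
    intro s h0
    have := hγ s 1
    rw [h0, map_zero, map_eq_zero_iff γ γ.injective] at this
    exact single_ne_zero x s one_ne_zero this
  obtain ⟨φ, hφ⟩ := exists_mulAut (fun s => hγ s 1) hk (fun s d => ⟨_, hγ s d⟩) hinj
  have hφe : ∀ e : Idem S, φ₀ e.toNZ = (σ e).toNZ := fun e =>
    NZ.ext_lid_rid (by rw [hl, lid_toNZ, lid_toNZ]) (by rw [hr, rid_toNZ, rid_toNZ])
  -- The restriction of γ to the corners, De → Dσ(e), is the future μ_e; surjectivity below comes
  -- from γ⁻¹ mapping the second corner into the first.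
  let m : Idem S → D →+ D := fun e =>
    (coeff x (σ e).toNZ).comp ((γ : TwistedRing x →+ TwistedRing x).comp (single x e.toNZ))
  have hm : ∀ e d, γ (single x e.toNZ d) = single x (σ e).toNZ (m e d) := by
    intro e d
    have := hγ e.toNZ d
    rw [hφe] at this
    exact this
  have hm1 : ∀ e, m e 1 = 1 := fun e =>
    (single_injective x _ ((hσ e).symm.trans (hm e 1))).symm
  have hmm : ∀ e d d', m e (d * d') = m e d * m e d' := by
    intro e d d'
    apply single_injective x (σ e).toNZ
    rw [← hm, ← single_toNZ_mul hx, map_mul, hm, hm, single_toNZ_mul hx]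
  have hmbij : ∀ e, Function.Bijective (m e) := by
    intro e
    refine ⟨fun d d' h => single_injective x e.toNZ (γ.injective (by rw [hm, hm, h])), fun d => ?_⟩
    have hs : γ.symm (single x (σ e).toNZ d) =
        idem x e * γ.symm (single x (σ e).toNZ d) * idem x e := by
      apply γ.injective
      simp only [map_mul, RingEquiv.apply_symm_apply, hσ]
      simp [idem, single_toNZ_mul hx]
    rw [idem_mul_mul_self hx] at hs
    refine ⟨coeff x e.toNZ (γ.symm (single x (σ e).toNZ d)), single_injective x (σ e).toNZ ?_⟩
    rw [← hm, ← hs, RingEquiv.apply_symm_apply]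
  let g : OneCochain S D :=
    { μ := fun e => RingEquiv.ofBijective
        ({ m e with map_one' := hm1 e, map_mul' := hmm e } : D →+* D) (hmbij e)
      η := fun s => Units.mk0 _ (hk s) }
  refine ⟨g, φ, fun t => ?_⟩
  have : (γ : TwistedRing x →+ TwistedRing x) = sigma x g φ := by
    refine hom_ext fun s d => ?_
    rw [sigma_single, hφ]
    change γ (single x s d) = single x (φ₀ s) (m (lid s) d * coeff x (φ₀ s) (γ (single x s 1)))
    -- The factorization ds = (de)(1s) separates the contribution of μ_e from that of η(s).
    rw [← mul_one d, ← single_lid_mul_single hx, map_mul, hm, hγ s 1, ← hl s,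
      single_lid_mul_single hx, mul_one, coeff_single]
  exact DFunLike.congr_fun this t

/-- Up to inner automorphisms, every automorphism has the form `d s ↦ μ_e(d) η(s) φ(s)`. -/
theorem exists_inner_mul_eq_sigma (hx : x.IsNormal)
    (hne : ∀ e f : Idem S, IdemEquiv (idem x e) (idem x f) → e = f) (γ : RingAut (TwistedRing x)) :
    ∃ (u : (TwistedRing x)ˣ) (g : OneCochain S D) (φ : MulAut S),
      ∀ t, (inner _ u * γ) t = sigma x g φ t := by
  have hE := completeOrthogonalIdempotents hx
  -- The second family is the image of the first under γ; γ⁻¹ carries an equivalence between its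
  -- members back to the first family.
  obtain ⟨u, σ, h⟩ := exists_unit_conj hE (hE.map γ.toRingHom) (divCorner hx)
    (fun e => (divCorner hx e).map γ) (fun e f h => hne e f (by
      simpa using h.map (γ.symm : TwistedRing x →+* TwistedRing x)))
  obtain ⟨g, φ, h'⟩ := exists_sigma_of_map_idem hx (inner _ u * γ) h
  exact ⟨u, g, φ, h'⟩

/-! ### Diagonal units and inner monomial automorphisms -/

/-- The element `∑ ε(e) e` of `D^α_ξ S`. -/
noncomputable def diag (x : TwoCocycle S D) (ε : Idem S → D) : TwistedRing x :=
  ∑ e : Idem S, single x e.toNZ (ε e)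

theorem diag_mul_single (hx : x.IsNormal) (ε : Idem S → D) (s : NZ S) (d : D) :
    diag x ε * single x s d = single x s (ε (lid s) * d) := by
  rw [diag, Finset.sum_mul, Finset.sum_eq_single (lid s) (fun e _ hne => ?_) (by simp),
    single_lid_mul_single hx]
  apply single_mul_single_of_eq
  by_contra h
  exact hne (eq_lid s e h)

theorem single_mul_diag (hx : x.IsNormal) (ε : Idem S → D) (s : NZ S) (d : D) :
    single x s d * diag x ε = single x s (d * x.α s (ε (rid s))) := by
  rw [diag, Finset.mul_sum, Finset.sum_eq_single (rid s) (fun e _ hne => ?_) (by simp),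
    single_mul_single_rid hx]
  apply single_mul_single_of_eq
  by_contra h
  exact hne (eq_rid s e h)

theorem diag_mul_diag (hx : x.IsNormal) (ε ε' : Idem S → D) :
    diag x ε * diag x ε' = diag x (fun e => ε e * ε' e) := by
  conv_lhs => rw [diag.eq_def x ε', Finset.mul_sum]
  refine Finset.sum_congr rfl fun e _ => ?_
  rw [diag_mul_single hx, lid_toNZ]

theorem diag_one (hx : x.IsNormal) : diag x (fun _ => 1) = 1 := (one_eq hx).symm

/-- Conjugation by `∑ ε(e) e` is the automorphism given by the coboundary of `ε`. -/
theorem inner_eq_sigma_coboundary (hx : x.IsNormal) (ε : Idem S → Dˣ) {u : (TwistedRing x)ˣ}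
    (hu : (u : TwistedRing x) = diag x fun e => ε e) (t : TwistedRing x) :
    inner _ u t = sigma x (TwoCocycle.coboundary x ε) 1 t := by
  have : (inner _ u : TwistedRing x →+ TwistedRing x) =
      sigma x (TwoCocycle.coboundary x ε) 1 := by
    refine hom_ext fun s d => ?_
    change u * single x s d * (u⁻¹ : (TwistedRing x)ˣ) = _
    rw [Units.mul_inv_eq_iff_eq_mul, hu, diag_mul_single hx, sigma_single]
    change _ = single x s (ε (lid s) * d * ((ε (lid s))⁻¹ : Dˣ) *
      (ε (lid s) * x.α s ((ε (rid s))⁻¹ : Dˣ))) * _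
    rw [single_mul_diag hx, ← mul_assoc, Units.inv_mul_cancel_right, mul_assoc, ← map_mul,
      Units.inv_mul, map_one, mul_one]
  exact DFunLike.congr_fun this t

theorem exists_inner_eq_sigma_coboundary (hx : x.IsNormal) (ε : Idem S → Dˣ) :
    ∃ u : (TwistedRing x)ˣ, ∀ t, inner _ u t = sigma x (TwoCocycle.coboundary x ε) 1 t :=
  ⟨⟨diag x fun e => ε e, diag x fun e => ((ε e)⁻¹ : Dˣ), by
    rw [diag_mul_diag hx]; simp [diag_one hx], by rw [diag_mul_diag hx]; simp [diag_one hx]⟩,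
    inner_eq_sigma_coboundary hx ε rfl⟩

/-- If an inner automorphism has the form `d s ↦ μ_e(d) η(s) φ(s)`, then `φ = 1` and `(μ, η)` is a
coboundary. -/
theorem eq_of_inner_eq_sigma (hx : x.IsNormal)
    (hne : ∀ e f : Idem S, IdemEquiv (idem x e) (idem x f) → e = f) (u : (TwistedRing x)ˣ)
    {g : OneCochain S D} {φ : MulAut S} (h : ∀ t, inner _ u t = sigma x g φ t) :
    φ = 1 ∧ ∃ ε : Idem S → Dˣ, g = TwoCocycle.coboundary x ε := by
  have hη := η_toNZ_of_map_mul hx (g := g) (φ := φ) (fun a b => by rw [← h, ← h, ← h, map_mul])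
  have hidem : ∀ e, u * idem x e * (u⁻¹ : (TwistedRing x)ˣ) = idem x (Idem.map φ e) := by
    intro e
    have := h (idem x e)
    rw [inner_apply] at this
    rw [this, idem, sigma_single, hη, map_one, Units.val_one, mul_one]
    rfl
  have hii : ∀ e, idem x e * idem x e = idem x e := fun e => (divCorner hx e).idem
  have hφe : ∀ e, Idem.map φ e = e := by
    intro e
    -- φ(e) corresponds to the conjugate of e by u, and a conjugate is equivalent to e through e u⁻¹
    -- and u e.
    refine (hne e _ ⟨idem x e * (u⁻¹ : (TwistedRing x)ˣ), u * idem x e, ?_, ?_, ?_, ?_, ?_, ?_⟩).symm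
    · rw [mul_assoc, Units.inv_mul_cancel_left, hii]
    · rw [← hidem, ← mul_assoc, mul_assoc (u : TwistedRing x), hii]
    · rw [← mul_assoc, hii]
    · rw [← hidem, mul_assoc, mul_assoc (u : TwistedRing x), Units.inv_mul_cancel_left, ← mul_assoc,
        hii]
    · rw [← hidem, ← mul_assoc, Units.inv_mul_cancel_right, mul_assoc, hii]
    · rw [mul_assoc, hii]
  have hφ : φ = 1 := MulAut.eq_one_of_idem_map hφe
  refine ⟨hφ, ?_⟩
  -- With φ = 1, u commutes with every idempotent, so it has no off-diagonal Peirce components; its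
  -- diagonal coefficients form ε.
  have hcomm : ∀ e, u * idem x e = idem x e * u := fun e => by
    rw [← Units.mul_inv_eq_iff_eq_mul, hidem, hφe]
  have hcorner : ∀ e, u * idem x e = single x e.toNZ (coeff x e.toNZ u) := fun e => by
    rw [← idem_mul_mul_self hx, ← hcomm, mul_assoc, hii]
  have hu : (u : TwistedRing x) = diag x fun e => coeff x e.toNZ u := by
    conv_lhs => rw [← mul_one (u : TwistedRing x), one_eq hx, Finset.mul_sum]
    exact Finset.sum_congr rfl fun e _ => hcorner e
  have hne0 : ∀ e : Idem S, coeff x e.toNZ (u : TwistedRing x) ≠ 0 := by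
    intro e h0
    have h1 := hcorner e
    rw [h0, map_zero] at h1
    apply (divCorner hx e).ne_zero
    rw [← Units.inv_mul_cancel_left u (idem x e), h1, mul_zero]
  let ε : Idem S → Dˣ := fun e => Units.mk0 _ (hne0 e)
  have hε := inner_eq_sigma_coboundary hx ε (u := u) hu
  subst hφ
  refine ⟨ε, sigma_injective x (φ := 1) (φ' := 1) (fun s d => by rw [← h, ← hε]) fun e => ?_⟩
  rw [hη, η_toNZ_of_map_mul hx (fun a b => by rw [← hε, ← hε, ← hε, map_mul])]

/-- The automorphism `d s ↦ μ_e(d) η(s) φ(s)`, for `(μ, η) * (α^φ, ξ^φ) = (α, ξ)`. -/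
noncomputable def sigmaAut {g : OneCochain S D} {φ : MulAut S}
    (h : TwoCocycle.Carries g (x.comap φ) x) : RingAut (TwistedRing x) where
  toFun := sigma x g φ
  -- By `sigma_sigma` a left inverse (h, φ⁻¹) must satisfy `h.comap φ * g = 1`.
  invFun := sigma x (g⁻¹.comap φ⁻¹) φ⁻¹
  left_inv t := by
    have : ((g⁻¹).comap φ⁻¹).comap φ = g⁻¹ := by
      have : ((g⁻¹).comap φ⁻¹).comap φ = (g⁻¹).comap (φ⁻¹ * φ) := rfl
      rw [this, inv_mul_cancel]
      rfl
    rw [sigma_sigma, this, inv_mul_cancel, inv_mul_cancel, sigma_one_one]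
  right_inv t := by
    rw [sigma_sigma, ← OneCochain.mul_comap, mul_inv_cancel, mul_inv_cancel,
      OneCochain.one_comap, sigma_one_one]
  map_mul' := map_mul_of_carries h
  map_add' := map_add _

end TwistedRing

variable {R : Type u} [Ring R] {S : Type v} [SemigroupWithZero S] [SquareFreeSemigroup S]
  {D : Type w} [DivisionRing D] {x : TwoCocycle S D} {ι : R ≃+* TwistedRing x}

open TwistedRing

/-! ### Automorphisms of a ring identified with a twisted semigroup ring -/

theorem eq_of_idemEquiv_idem (hR : IsBasicRing R) (ι : R ≃+* TwistedRing x) (hx : x.IsNormal)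
    (e f : Idem S) (h : IdemEquiv (idem x e) (idem x f)) : e = f := by
  by_contra hef
  refine hR.not_idemEquiv ((divCorner hx e).map ι.symm) (f := ι.symm (idem x f)) ?_
    (h.map (ι.symm : TwistedRing x →+* R))
  rw [← map_mul, (completeOrthogonalIdempotents hx).ortho hef, map_zero]

/-- Under `ι`, the automorphism `γ` is `d s ↦ μ_e(d) η(s) φ(s)`. -/
def IsMonomial (ι : R ≃+* TwistedRing x) (γ : RingAut R) (g : OneCochain S D) (φ : MulAut S) :
    Prop :=
  ∀ r, ι (γ r) = sigma x g φ (ι r)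

theorem IsMonomial.mul {γ γ' : RingAut R} {g g' : OneCochain S D} {φ φ' : MulAut S}
    (h : IsMonomial ι γ g φ) (h' : IsMonomial ι γ' g' φ') :
    IsMonomial ι (γ * γ') (g.comap φ' * g') (φ * φ') := fun r => by
  rw [RingAut.mul_apply, h, h', sigma_sigma]

theorem IsMonomial.eq {γ γ' : RingAut R} {g : OneCochain S D} {φ : MulAut S}
    (h : IsMonomial ι γ g φ) (h' : IsMonomial ι γ' g φ) : γ = γ' :=
  RingEquiv.ext fun r => ι.injective (by rw [h, h'])

theorem IsMonomial.carries (hx : x.IsNormal) {γ : RingAut R} {g : OneCochain S D} {φ : MulAut S}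
    (h : IsMonomial ι γ g φ) : TwoCocycle.Carries g (x.comap φ) x := by
  refine carries_of_map_mul hx fun a b => ?_
  obtain ⟨a, rfl⟩ := ι.surjective a
  obtain ⟨b, rfl⟩ := ι.surjective b
  rw [← map_mul, ← h, ← h, ← h, map_mul, map_mul]

theorem IsMonomial.mem_stab (hx : x.IsNormal) {γ : RingAut R} {g : OneCochain S D} {φ : MulAut S}
    (h : IsMonomial ι γ g φ) : φ ∈ x.stab :=
  ⟨g⁻¹, (h.carries hx).inv⟩

/-- The automorphism of `R` corresponding to `d s ↦ μ_e(d) η(s) φ(s)`. -/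
noncomputable def monomialAut (ι : R ≃+* TwistedRing x) {g : OneCochain S D} {φ : MulAut S}
    (h : TwoCocycle.Carries g (x.comap φ) x) : RingAut R :=
  (ι.trans (sigmaAut h)).trans ι.symm

theorem isMonomial_monomialAut (ι : R ≃+* TwistedRing x) {g : OneCochain S D} {φ : MulAut S}
    (h : TwoCocycle.Carries g (x.comap φ) x) : IsMonomial ι (monomialAut ι h) g φ :=
  fun r => ι.apply_symm_apply (sigma x g φ (ι r))

theorem map_inner_apply (ι : R ≃+* TwistedRing x) (u : Rˣ) (r : R) :
    ι (inner R u r) = inner _ (Units.map (ι : R →* TwistedRing x) u) (ι r) := by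
  simp [← map_inv]

theorem Out.mk_inner_mul (u : Rˣ) (γ : RingAut R) :
    (QuotientGroup.mk (inner R u * γ) : Out R) = QuotientGroup.mk γ := by
  rw [QuotientGroup.mk_mul, (QuotientGroup.eq_one_iff _).2 (show inner R u ∈ Inn R from ⟨u, rfl⟩),
    one_mul]

theorem exists_isMonomial_inner_mul (hR : IsBasicRing R) (ι : R ≃+* TwistedRing x)
    (hx : x.IsNormal) (γ : RingAut R) :
    ∃ (u : Rˣ) (g : OneCochain S D) (φ : MulAut S), IsMonomial ι (inner R u * γ) g φ := by
  obtain ⟨u, g, φ, h⟩ := exists_inner_mul_eq_sigma hx (eq_of_idemEquiv_idem hR ι hx)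
    ((ι.symm.trans γ).trans ι)
  refine ⟨Units.map (ι.symm : TwistedRing x →* R) u, g, φ, fun r => ?_⟩
  rw [← h, RingAut.mul_apply, RingAut.mul_apply, map_inner_apply]
  have h1 : Units.map (ι : R →* TwistedRing x) (Units.map (ι.symm : TwistedRing x →* R) u) = u := by
    ext
    simp
  rw [h1]
  simp

theorem IsMonomial.of_inner (hR : IsBasicRing R) (hx : x.IsNormal) {u : Rˣ} {g : OneCochain S D}
    {φ : MulAut S} (h : IsMonomial ι (inner R u) g φ) :
    φ = 1 ∧ ∃ ε : Idem S → Dˣ, g = TwoCocycle.coboundary x ε := by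
  refine eq_of_inner_eq_sigma hx (eq_of_idemEquiv_idem hR ι hx)
    (Units.map (ι : R →* TwistedRing x) u) fun t => ?_
  obtain ⟨r, rfl⟩ := ι.surjective t
  rw [← map_inner_apply, h]

theorem exists_isMonomial_inner_coboundary (ι : R ≃+* TwistedRing x) (hx : x.IsNormal)
    (ε : Idem S → Dˣ) :
    ∃ u : Rˣ, IsMonomial ι (inner R u) (TwoCocycle.coboundary x ε) 1 := by
  obtain ⟨u, hu⟩ := exists_inner_eq_sigma_coboundary hx ε
  refine ⟨Units.map (ι.symm : TwistedRing x →* R) u, fun r => ?_⟩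
  rw [map_inner_apply, ← hu]
  congr 2
  ext
  simp

/-- φ is quantified first so that a choice from this statement yields the value of Φ on the class.
-/
theorem exists_isMonomial (hR : IsBasicRing R) (ι : R ≃+* TwistedRing x) (hx : x.IsNormal)
    (o : Out R) :
    ∃ (φ : MulAut S) (γ : RingAut R) (g : OneCochain S D),
      o = QuotientGroup.mk γ ∧ IsMonomial ι γ g φ := by
  obtain ⟨γ, rfl⟩ := QuotientGroup.mk_surjective o
  obtain ⟨u, g, φ, h⟩ := exists_isMonomial_inner_mul hR ι hx γ
  exact ⟨φ, _, g, (Out.mk_inner_mul u γ).symm, h⟩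

/-- The class in `Out R` of an automorphism `d s ↦ μ_e(d) η(s) φ(s)` determines `φ`. -/
theorem IsMonomial.eq_of_mk_eq (hR : IsBasicRing R) (hx : x.IsNormal) {γ γ' : RingAut R}
    {g g' : OneCochain S D} {φ φ' : MulAut S} (h : IsMonomial ι γ g φ)
    (h' : IsMonomial ι γ' g' φ') (hγ : (QuotientGroup.mk γ : Out R) = QuotientGroup.mk γ') :
    φ = φ' := by
  -- With a monomial δ in the inverse class, δγ and δγ' are both monomial and inner, so ψφ = 1 =
  -- ψφ'.
  obtain ⟨ψ, δ, k, hδ, hk⟩ := exists_isMonomial hR ι hx (QuotientGroup.mk γ)⁻¹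
  have key : ∀ {γ₁ : RingAut R} {g₁ φ₁}, IsMonomial ι γ₁ g₁ φ₁ →
      (QuotientGroup.mk γ : Out R) = QuotientGroup.mk γ₁ → ψ * φ₁ = 1 := by
    intro γ₁ g₁ φ₁ h₁ he
    have h2 : (QuotientGroup.mk (δ * γ₁) : Out R) = 1 := by
      rw [QuotientGroup.mk_mul, ← hδ, he, inv_mul_cancel]
    obtain ⟨u, hu⟩ := (QuotientGroup.eq_one_iff _).1 h2
    have h3 := hk.mul h₁
    rw [← hu] at h3
    exact (h3.of_inner hR hx).1
  exact mul_left_cancel ((key h rfl).trans (key h' hγ).symm)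

/-! ### The maps Λ and Φ and exactness -/

/-- The homomorphism sending a 1-cocycle `(μ, η)` to the automorphism `d s ↦ μ_e(d) η(s) s`. -/
noncomputable def autOfZ1 (ι : R ≃+* TwistedRing x) : x.Z1 →* RingAut R where
  -- `x.comap 1` is definitionally x, so membership in `Z1` is the required `Carries` hypothesis.
  toFun z := monomialAut ι (g := z.1) (φ := 1) z.2
  map_one' := by
    refine IsMonomial.eq (ι := ι) (g := 1) (φ := 1) (isMonomial_monomialAut ι _) fun r => ?_
    rw [sigma_one_one]
    rfl
  map_mul' z z' := by
    refine IsMonomial.eq (ι := ι) (g := z.1 * z'.1) (φ := 1) (isMonomial_monomialAut ι _) ?_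
    exact IsMonomial.mul (g := z.1) (g' := z'.1) (φ := 1) (φ' := 1) (isMonomial_monomialAut ι _)
      (isMonomial_monomialAut ι _)

theorem isMonomial_autOfZ1 (ι : R ≃+* TwistedRing x) (z : x.Z1) :
    IsMonomial ι (autOfZ1 ι z) z.1 1 :=
  isMonomial_monomialAut ι (φ := 1) z.2

/-- The homomorphism `Λ : H¹ → Out R`. -/
noncomputable def outOfH1 (ι : R ≃+* TwistedRing x) (hx : x.IsNormal) : x.H1 →* Out R :=
  QuotientGroup.map (TwoCocycle.B1 x) (Inn R) (autOfZ1 ι) (by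
    rintro _ ⟨ε, rfl⟩
    obtain ⟨u, hu⟩ := exists_isMonomial_inner_coboundary ι hx ε
    exact ⟨u, hu.eq (isMonomial_autOfZ1 ι _)⟩)

theorem IsMonomial.outOfH1_mk (hx : x.IsNormal) {z : x.Z1} {γ : RingAut R}
    (h : IsMonomial ι γ z.1 1) : outOfH1 ι hx (QuotientGroup.mk z) = QuotientGroup.mk γ :=
  congrArg QuotientGroup.mk ((isMonomial_autOfZ1 ι z).eq h)

/-- A cocycle in the kernel gives an inner monomial automorphism, and such an automorphism comes
from a coboundary. -/
theorem outOfH1_injective (hR : IsBasicRing R) (hx : x.IsNormal) :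
    Function.Injective (outOfH1 ι hx) := by
  rw [injective_iff_map_eq_one]
  intro o ho
  obtain ⟨z, rfl⟩ := QuotientGroup.mk_surjective o
  have hz := isMonomial_autOfZ1 ι z
  rw [hz.outOfH1_mk hx] at ho
  obtain ⟨u, hu⟩ := (QuotientGroup.eq_one_iff _).1 ho
  rw [← hu] at hz
  obtain ⟨ε, hε⟩ := (hz.of_inner hR hx).2
  exact (QuotientGroup.eq_one_iff _).2 ⟨ε, Subtype.ext hε.symm⟩

/-- The homomorphism `Φ : Out R → Stab_{[α, ξ]}(Aut S)`. -/
noncomputable def stabOfOut (hR : IsBasicRing R) (ι : R ≃+* TwistedRing x) (hx : x.IsNormal) :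
    Out R →* x.stab :=
  MonoidHom.mk'
    (fun o => ⟨(exists_isMonomial hR ι hx o).choose,
      (exists_isMonomial hR ι hx o).choose_spec.choose_spec.choose_spec.2.mem_stab hx⟩)
    fun o o' => Subtype.ext <| by
      obtain ⟨γ, g, h1, h2⟩ := (exists_isMonomial hR ι hx o).choose_spec
      obtain ⟨γ', g', h1', h2'⟩ := (exists_isMonomial hR ι hx o').choose_spec
      obtain ⟨γ'', g'', h1'', h2''⟩ := (exists_isMonomial hR ι hx (o * o')).choose_spec
      -- Multiplicativity does not depend on the choices: φ is determined by the class, and a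
      -- product of monomial automorphisms is monomial with the product permutation.
      refine h2''.eq_of_mk_eq hR hx (h2.mul h2') ?_
      rw [← h1'', QuotientGroup.mk_mul, ← h1, ← h1']

theorem exists_isMonomial_stabOfOut (hR : IsBasicRing R) (ι : R ≃+* TwistedRing x)
    (hx : x.IsNormal) (o : Out R) : ∃ (γ : RingAut R) (g : OneCochain S D),
      o = QuotientGroup.mk γ ∧ IsMonomial ι γ g (stabOfOut hR ι hx o) :=
  (exists_isMonomial hR ι hx o).choose_spec

theorem IsMonomial.stabOfOut_mk (hR : IsBasicRing R) (hx : x.IsNormal) {γ : RingAut R}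
    {g : OneCochain S D} {φ : MulAut S} (h : IsMonomial ι γ g φ) :
    (stabOfOut hR ι hx (QuotientGroup.mk γ) : MulAut S) = φ := by
  obtain ⟨γ', g', h1, h2⟩ := exists_isMonomial_stabOfOut hR ι hx (QuotientGroup.mk γ)
  exact h2.eq_of_mk_eq hR hx h h1.symm

/-- A monomial automorphism with φ = 1 has a pair carrying x to itself, that is, a 1-cocycle. -/
theorem range_outOfH1 (hR : IsBasicRing R) (hx : x.IsNormal) :
    (outOfH1 ι hx).range = (stabOfOut hR ι hx).ker := by
  ext o
  rw [MonoidHom.mem_ker]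
  constructor
  · rintro ⟨h, rfl⟩
    obtain ⟨z, rfl⟩ := QuotientGroup.mk_surjective h
    have hz := isMonomial_autOfZ1 ι z
    rw [hz.outOfH1_mk hx]
    exact Subtype.ext (hz.stabOfOut_mk hR hx)
  · intro ho
    obtain ⟨γ, g, rfl, h⟩ := exists_isMonomial_stabOfOut hR ι hx o
    rw [ho] at h
    exact ⟨QuotientGroup.mk ⟨g, h.carries hx⟩, IsMonomial.outOfH1_mk hx h⟩

/-- For φ in the stabilizer some g carries x to `x.comap φ`; its inverse carries back and defines a
monomial automorphism over φ. -/
theorem stabOfOut_surjective (hR : IsBasicRing R) (hx : x.IsNormal) :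
    Function.Surjective (stabOfOut hR ι hx) := by
  rintro ⟨φ, g, hg⟩
  exact ⟨QuotientGroup.mk (monomialAut ι hg.inv),
    Subtype.ext ((isMonomial_monomialAut ι hg.inv).stabOfOut_mk hR hx)⟩

/-! ### The trivial class and the splitting -/

section Trivial

variable {g : OneCochain S D}

/-- The trivial cocycle is its own pullback: the pullback of g carries `x.comap φ` to it, and g⁻¹
carries it on to x. The resulting monomial map is ds ↦ dφ(s) conjugated by the map of g. -/
theorem Carries.carries_comap (h : TwoCocycle.Carries g x (TwoCocycle.trivial S D))
    (φ : MulAut S) : TwoCocycle.Carries (g.comap φ * g⁻¹) (x.comap φ) x :=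
  TwoCocycle.Carries.mul (TwoCocycle.Carries.comap φ h) h.inv

theorem stab_eq_top (h : TwoCocycle.Carries g x (TwoCocycle.trivial S D)) : x.stab = ⊤ :=
  eq_top_iff.2 fun φ _ => ⟨_, (Carries.carries_comap h φ).inv⟩

/-- The splitting `Ψ : Aut S → Out R` given by a pair `(μ, η)` with `(μ, η) * (α, ξ) = (1, 1)`. -/
noncomputable def outOfMulAut (ι : R ≃+* TwistedRing x)
    (h : TwoCocycle.Carries g x (TwoCocycle.trivial S D)) : MulAut S →* Out R :=
  (QuotientGroup.mk' (Inn R)).comp <| MonoidHom.mk'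
    (fun φ => monomialAut ι (Carries.carries_comap h φ)) fun φ ψ => by
      have h1 := (isMonomial_monomialAut ι (Carries.carries_comap h φ)).mul
        (isMonomial_monomialAut ι (Carries.carries_comap h ψ))
      -- The product telescopes: the pullbacks of g⁻¹ and g along ψ cancel in the middle.
      have h2 : (g.comap φ * g⁻¹).comap ψ * (g.comap ψ * g⁻¹) = g.comap (φ * ψ) * g⁻¹ := by
        rw [OneCochain.mul_comap, mul_assoc, ← mul_assoc _ (g.comap ψ), ← OneCochain.mul_comap,
          inv_mul_cancel, OneCochain.one_comap, one_mul]
        rfl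
      rw [h2] at h1
      exact (isMonomial_monomialAut ι _).eq h1

theorem stabOfOut_outOfMulAut (hR : IsBasicRing R) (hx : x.IsNormal)
    (h : TwoCocycle.Carries g x (TwoCocycle.trivial S D)) (φ : MulAut S) :
    (stabOfOut hR ι hx (outOfMulAut ι h φ) : MulAut S) = φ :=
  (isMonomial_monomialAut ι (Carries.carries_comap h φ)).stabOfOut_mk hR hx

end Trivial

end SquareFree

/-! ### Assembly of the theorem -/

theorem mainTheorem1 {R : Type*} [Ring R] (hR : SquareFree.IsSquareFreeRing R)
    {S : Type*} [SemigroupWithZero S] [SquareFree.SquareFreeSemigroup S]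
    {D : Type*} [DivisionRing D]
    (x : SquareFree.TwoCocycle S D) (hx : x.IsNormal)
    (ι : R ≃+* SquareFree.TwistedRing x) :
    ∃ (Λ : x.H1 →* SquareFree.Out R) (Φ : SquareFree.Out R →* x.stab),
      -- `Λ` sends the class of `(μ, η)` to the class of `d s ↦ μ_e(d) η(s) s`
      (∀ z : x.Z1, ∃ γ : RingAut R,
        (∀ r, ι (γ r) = SquareFree.TwistedRing.sigma x z 1 (ι r)) ∧
        Λ (QuotientGroup.mk z) = QuotientGroup.mk γ) ∧
      -- `Φ` sends the class of `d s ↦ μ_e(d) η(s) φ(s)` to `φ`, and each class is of this form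
      (∀ (γ : RingAut R) (g : SquareFree.OneCochain S D) (φ : MulAut S),
        (∀ r, ι (γ r) = SquareFree.TwistedRing.sigma x g φ (ι r)) →
        (Φ (QuotientGroup.mk γ) : MulAut S) = φ) ∧
      (∀ o : SquareFree.Out R, ∃ (γ : RingAut R) (g : SquareFree.OneCochain S D),
        o = QuotientGroup.mk γ ∧
        ∀ r, ι (γ r) = SquareFree.TwistedRing.sigma x g (Φ o) (ι r)) ∧
      -- exactness of `1 → H¹ → Out R → Stab → 1`
      Function.Injective Λ ∧ Λ.range = Φ.ker ∧ Function.Surjective Φ ∧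
      -- the case `[α, ξ] = [1_D, 1]`
      (SquareFree.TwoCocycle.Cohomologous x (SquareFree.TwoCocycle.trivial S D) →
        x.stab = ⊤ ∧
        Λ.range = (x.stab.subtype.comp Φ).ker ∧
        Function.Surjective (x.stab.subtype.comp Φ) ∧
        ∃ Ψ : MulAut S →* SquareFree.Out R,
          (x.stab.subtype.comp Φ).comp Ψ = MonoidHom.id (MulAut S) ∧
          ∃ (τ : MulAut S →* MulAut x.H1) (F : x.H1 ⋊[τ] MulAut S ≃* SquareFree.Out R),
            ∀ (h : x.H1) (φ : MulAut S), F ⟨h, φ⟩ = Λ h * Ψ φ) := by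
  open SquareFree in
  have hinj := outOfH1_injective (ι := ι) hR.basic hx
  have hexact := range_outOfH1 (ι := ι) hR.basic hx
  refine ⟨outOfH1 ι hx, stabOfOut hR.basic ι hx,
    fun z => ⟨_, isMonomial_autOfZ1 ι z, rfl⟩,
    fun γ g φ h => IsMonomial.stabOfOut_mk hR.basic hx h,
    exists_isMonomial_stabOfOut hR.basic ι hx, hinj, hexact, stabOfOut_surjective hR.basic hx, ?_⟩
  rintro ⟨g, hg⟩
  have hΨ := stabOfOut_outOfMulAut (ι := ι) hR.basic hx hg
  have hker : (outOfH1 ι hx).range = (x.stab.subtype.comp (stabOfOut hR.basic ι hx)).ker := by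
    rw [hexact, MonoidHom.ker_comp_of_injective _ _ x.stab.subtype_injective]
  have hsurj : Function.Surjective (x.stab.subtype.comp (stabOfOut hR.basic ι hx)) :=
    fun φ => ⟨_, hΨ φ⟩
  -- In the trivial case the sequence is a group extension split by Ψ, so Out R is a semidirect
  -- product for the conjugation action through Ψ.
  let X : GroupExtension x.H1 (Out R) (MulAut S) := ⟨_, _, hinj, hker, hsurj⟩
  let s : X.Splitting := ⟨outOfMulAut ι hg, hΨ⟩
  exact ⟨stab_eq_top hg, hker, hsurj, outOfMulAut ι hg, MonoidHom.ext hΨ, s.conjAct,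
    s.semidirectProductMulEquiv, fun h φ => rfl⟩
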